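/- Let $k$ be an algebraically closed field of characteristic $p>0$, let $W=W(k)$ be its ring of Witt vectors with Frobenius $\sigma$, and let $K=W[1/p]$. A Dieudonné module is a free finitely generated $W$-module $M$ with a $\sigma$-linear operator $F$ and a $\sigma^{-1}$-linear operator $V$ such that $FV=VF=p$, that is, a module over the Dieudonné ring $\mathbb E=W_\sigma[F,V]$ which is free and finitely generated over $W$. Dieudonné modules $M$, $M'$ are called isogenous if $M\otimes_W K$ and $M'\otimes_W K$ are isomorphic as $\mathbb E$-modules. For Dieudonné modules $M$ and $N$, the $W$-modules $\wedge^2M$ and $M\otimes N=M\otimes_WN$ are F-crystals (free finitely generated $W$-modules with an injective $\sigma$-linear endomorphism $F$), with $F(x\wedge y)=Fx\wedge Fy$ and $F(x\otimes y)=Fx\otimes Fy$. For an F-crystal $L$ put $\mathrm F^1_N(L)=\{x\in L: p\mid F(x)\}$. Let $\mathbf L\cong\mathbf W^{\mathrm{rk}_W(L)}$ be the pro-algebraic group over $k$ (in the sense of Serre) with $\mathbf L(k)=L$, where $\mathbf W$ is the perfection of the group scheme of Witt vectors, let $\mathrm F^1_N(\mathbf L)\subset\mathbf L$ be the closed subgroup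 with group of $k$-points $\mathrm F^1_N(L)$, and let $$\mathbf U_L=\mathrm{Coker}\left[F/p-1\colon \mathrm F^1_N(\mathbf L)\to\mathbf L\right]$$ be the cokernel in the category of pro-algebraic groups over $k$. Then for all Dieudonné modules $M$ and $N$ the dimensions $\dim(\mathbf U_{\wedge^2M})$ and $\dim(\mathbf U_{M\otimes N})$ are (finite) integers which depend only on the isogeny classes of $M$ and $N$: if $M'$ is isogenous to $M$ and $N'$ is isogenous to $N$, then $$\dim(\mathbf U_{\wedge^2M})=\dim(\mathbf U_{\wedge^2M'})<\infty,\qquad \dim(\mathbf U_{M\otimes N})=\dim(\mathbf U_{M'\otimes N'})<\infty.$$ -/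

import Mathlib

open scoped TensorProduct

noncomputable section

set_option linter.unusedSectionVars false

namespace Dieudonne

universe u v w

/-! ### Semilinear exterior powers -/

section Exterior

variable {R : Type*} [CommRing R] (σ : R →+* R)

/-- The abelian group `P` with the `R`-module structure `r • x = σ r • x`. -/
def Twist (_ : R →+* R) (P : Type*) : Type _ := P

instance (P : Type*) [AddCommGroup P] : AddCommGroup (Twist σ P) :=
  inferInstanceAs (AddCommGroup P)

instance (P : Type*) [AddCommGroup P] [Module R P] : Module R (Twist σ P) :=
  Module.compHom P σ

variable {σ} {M : Type*} [AddCommGroup M] [Module R M]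

/-- The alternating map `(x₁, …, xₙ) ↦ f x₁ ∧ ⋯ ∧ f xₙ` with values in the twist of `⋀ⁿ M`. -/
def twistAlternating (n : ℕ) (f : M →ₛₗ[σ] M) :
    M [⋀^Fin n]→ₗ[R] (Twist σ (⋀[R]^n M)) where
  toFun x := (exteriorPower.ιMulti R n (fun i => f (x i)) : ⋀[R]^n M)
  map_update_add' {inst} x i a b := by
    have hu : ∀ c : M, (fun j => f (Function.update x i c j)) =
        Function.update (fun j => f (x j)) i (f c) := fun c => by
      funext j
      by_cases h : j = i
      · subst h; simp
      · simp [h]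
    simp only [hu, map_add]
    exact (exteriorPower.ιMulti R n).map_update_add (fun j => f (x j)) i (f a) (f b)
  map_update_smul' {inst} x i c a := by
    have hu : ∀ c : M, (fun j => f (Function.update x i c j)) =
        Function.update (fun j => f (x j)) i (f c) := fun c => by
      funext j
      by_cases h : j = i
      · subst h; simp
      · simp [h]
    simp only [hu, LinearMap.map_smulₛₗ]
    exact (exteriorPower.ιMulti R n).map_update_smul (fun j => f (x j)) i (σ c) (f a)
  map_eq_zero_of_eq' x i j hij hne :=
    (exteriorPower.ιMulti R n).map_eq_zero_of_eq (fun j => f (x j)) (by simp [hij]) hne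

/-- The `σ`-linear endomorphism `x₁ ∧ ⋯ ∧ xₙ ↦ f x₁ ∧ ⋯ ∧ f xₙ` of `⋀ⁿ M` induced by a
`σ`-linear endomorphism `f` of `M`. -/
def exteriorMap (n : ℕ) (f : M →ₛₗ[σ] M) : ⋀[R]^n M →ₛₗ[σ] ⋀[R]^n M where
  toFun x := (exteriorPower.alternatingMapLinearEquiv (twistAlternating n f) x :
    Twist σ (⋀[R]^n M))
  map_add' x y := map_add (exteriorPower.alternatingMapLinearEquiv (twistAlternating n f)) x y
  map_smul' c x :=
    map_smul (exteriorPower.alternatingMapLinearEquiv (twistAlternating n f)) c x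

theorem exteriorMap_ιMulti (n : ℕ) (f : M →ₛₗ[σ] M) (x : Fin n → M) :
    exteriorMap n f (exteriorPower.ιMulti R n x) =
      exteriorPower.ιMulti R n (fun i => f (x i)) :=
  exteriorPower.alternatingMapLinearEquiv_apply_ιMulti (twistAlternating n f) x

end Exterior

/-! ### F-crystals and Dieudonné modules -/

section Modules

variable (p : ℕ) [Fact p.Prime] (k : Type u) [Field k] [IsAlgClosed k] [CharP k p]

/-- The Frobenius automorphism `σ` of `W = W(k)`, as a ring homomorphism. -/
abbrev sigma : WittVector p k →+* WittVector p k := WittVector.frobenius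

/-- The inverse `σ⁻¹` of the Frobenius of `W = W(k)`, as a ring homomorphism. -/
abbrev sigmaInv : WittVector p k →+* WittVector p k := (WittVector.frobeniusEquiv p k).symm

/-- An F-crystal: a finitely generated free `W`-module with an injective `σ`-linear
endomorphism. -/
structure FCrystal where
  carrier : Type v
  [addCommGroup : AddCommGroup carrier]
  [module : Module (WittVector p k) carrier]
  [free : Module.Free (WittVector p k) carrier]
  [finite : Module.Finite (WittVector p k) carrier]
  F : carrier →ₛₗ[sigma p k] carrier
  F_injective : Function.Injective F

instance : CoeSort (FCrystal.{u, v} p k) (Type v) := ⟨FCrystal.carrier⟩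

attribute [instance] FCrystal.addCommGroup FCrystal.module FCrystal.free FCrystal.finite

/-- A Dieudonné module: a module over the Dieudonné ring `W_σ[F, V]` which is finitely generated
and free over `W`. An action of `W_σ[F, V]` extending a `W`-module structure is the same as a
`σ`-linear operator `F` and a `σ⁻¹`-linear operator `V` with `FV = VF = p`. -/
structure DieudonneModule where
  carrier : Type v
  [addCommGroup : AddCommGroup carrier]
  [module : Module (WittVector p k) carrier]
  [free : Module.Free (WittVector p k) carrier]
  [finite : Module.Finite (WittVector p k) carrier]
  F : carrier →ₛₗ[sigma p k] carrier
  V : carrier →ₛₗ[sigmaInv p k] carrier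
  F_V : ∀ x, F (V x) = (p : WittVector p k) • x
  V_F : ∀ x, V (F x) = (p : WittVector p k) • x

instance : CoeSort (DieudonneModule.{u, v} p k) (Type v) := ⟨DieudonneModule.carrier⟩

attribute [instance] DieudonneModule.addCommGroup DieudonneModule.module DieudonneModule.free
  DieudonneModule.finite

variable {p k}

theorem p_smul_injective (L : Type*) [AddCommGroup L] [Module (WittVector p k) L]
    [Module.Free (WittVector p k) L] :
    Function.Injective (fun x : L => (p : WittVector p k) • x) :=
  smul_right_injective L (WittVector.p_nonzero p k)

theorem p_sq_smul_injective (L : Type*) [AddCommGroup L] [Module (WittVector p k) L]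
    [Module.Free (WittVector p k) L] :
    Function.Injective (fun x : L => ((p : WittVector p k) * p) • x) :=
  smul_right_injective L (mul_ne_zero (WittVector.p_nonzero p k) (WittVector.p_nonzero p k))

namespace DieudonneModule

theorem tensor_V_F (M : DieudonneModule.{u, v} p k) {N : DieudonneModule.{u, w} p k}
    (x : M ⊗[WittVector p k] N) :
    TensorProduct.map M.V N.V (TensorProduct.map M.F N.F x) =
      ((p : WittVector p k) * p) • x := by
  induction x with
  | zero => simp
  | add x y hx hy => simp [hx, hy]
  | tmul x y =>
    rw [TensorProduct.map_tmul, TensorProduct.map_tmul, M.V_F, N.V_F,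
      TensorProduct.smul_tmul_smul]

theorem exterior_V_F (M : DieudonneModule.{u, v} p k) (x : ⋀[WittVector p k]^2 M) :
    exteriorMap 2 M.V (exteriorMap 2 M.F x) = ((p : WittVector p k) * p) • x := by
  have hx : x ∈ Submodule.span (WittVector p k)
      (Set.range (exteriorPower.ιMulti (WittVector p k) 2 (M := M))) := by
    rw [exteriorPower.ιMulti_span]; trivial
  induction hx using Submodule.span_induction with
  | zero => simp
  | add x y _ _ hx hy => simp [hx, hy]
  | smul a x _ hx =>
    rw [LinearMap.map_smulₛₗ, LinearMap.map_smulₛₗ, hx, smul_comm _ a]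
    exact congrArg (fun b : WittVector p k => b • ((p : WittVector p k) * p) • x)
      ((WittVector.frobeniusEquiv p k).symm_apply_apply a)
  | mem x hx =>
    obtain ⟨y, rfl⟩ := hx
    rw [exteriorMap_ιMulti, exteriorMap_ιMulti]
    simp only [M.V_F]
    rw [AlternatingMap.map_smul_univ (exteriorPower.ιMulti (WittVector p k) 2)
      (fun _ => (p : WittVector p k)) y]
    simp [sq]

/-- The F-crystal `M ⊗_W N`, with `F (x ⊗ y) = F x ⊗ F y`. -/
def tensor (M : DieudonneModule.{u, v} p k) (N : DieudonneModule.{u, w} p k) :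
    FCrystal.{u, max v w} p k where
  carrier := M ⊗[WittVector p k] N
  F := TensorProduct.map M.F N.F
  F_injective x y h := p_sq_smul_injective _ <| by
    simpa only [tensor_V_F] using congrArg (TensorProduct.map M.V N.V) h

/-- The F-crystal `∧² M`, with `F (x ∧ y) = F x ∧ F y`. -/
def exteriorSquare (M : DieudonneModule.{u, v} p k) : FCrystal.{u, max u v} p k where
  carrier := ⋀[WittVector p k]^2 M
  F := exteriorMap 2 M.F
  F_injective x y h := p_sq_smul_injective _ <| by
    simpa only [exterior_V_F] using congrArg (exteriorMap 2 M.V) h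

/-! ### Isogenies -/

/-- The Frobenius of `K = Frac W = W[1/p]`, as a `σ`-linear map over `W`. -/
def fracSigma : FractionRing (WittVector p k) →ₛₗ[sigma p k] FractionRing (WittVector p k) where
  toFun := WittVector.FractionRing.frobenius p k
  map_add' := map_add _
  map_smul' a x := by
    rw [Algebra.smul_def, Algebra.smul_def, map_mul]
    congr 1
    exact IsFractionRing.ringEquivOfRingEquiv_algebraMap (WittVector.frobeniusEquiv p k) a

/-- The inverse Frobenius of `K = Frac W = W[1/p]`, as a `σ⁻¹`-linear map over `W`. -/
def fracSigmaInv :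
    FractionRing (WittVector p k) →ₛₗ[sigmaInv p k] FractionRing (WittVector p k) where
  toFun := (WittVector.FractionRing.frobenius p k).symm
  map_add' := map_add _
  map_smul' a x := by
    rw [Algebra.smul_def, Algebra.smul_def, map_mul]
    congr 1
    rw [RingEquiv.symm_apply_eq]
    refine Eq.trans ?_ (IsFractionRing.ringEquivOfRingEquiv_algebraMap
      (WittVector.frobeniusEquiv p k) _).symm
    exact congrArg _ ((WittVector.frobeniusEquiv p k).apply_symm_apply a).symm

/-- The module `K ⊗_W M` underlying the isocrystal of `M`. -/
abbrev Rational (M : DieudonneModule.{u, v} p k) : Type (max u v) :=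
  FractionRing (WittVector p k) ⊗[WittVector p k] M

/-- `F` acting on `K ⊗_W M` by `F (a ⊗ x) = σ a ⊗ F x`. -/
def rationalF (M : DieudonneModule.{u, v} p k) : M.Rational →ₛₗ[sigma p k] M.Rational :=
  TensorProduct.map fracSigma M.F

/-- `V` acting on `K ⊗_W M` by `V (a ⊗ x) = σ⁻¹ a ⊗ V x`. -/
def rationalV (M : DieudonneModule.{u, v} p k) : M.Rational →ₛₗ[sigmaInv p k] M.Rational :=
  TensorProduct.map fracSigmaInv M.V

/-- `M` and `M'` are isogenous if `M ⊗_W K` and `M' ⊗_W K` are isomorphic as modules over the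
Dieudonné ring. -/
def Isogenous (M : DieudonneModule.{u, v} p k) (M' : DieudonneModule.{u, w} p k) : Prop :=
  ∃ e : M.Rational ≃ₗ[WittVector p k] M'.Rational,
    (∀ x, e (M.rationalF x) = M'.rationalF (e x)) ∧
    (∀ x, e (M.rationalV x) = M'.rationalV (e x))

end DieudonneModule

/-! ### The unipotent quasi-algebraic group attached to an F-crystal -/

namespace FCrystal

variable (L : FCrystal.{u, v} p k)

/-- `F¹_N(L) = {x ∈ L : p ∣ F x}`. -/
def nygaard : Submodule (WittVector p k) L where
  carrier := {x | ∃ y, (p : WittVector p k) • y = L.F x}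
  zero_mem' := ⟨0, by simp⟩
  add_mem' := by
    rintro _ _ ⟨a, ha⟩ ⟨b, hb⟩
    exact ⟨a + b, by rw [smul_add, ha, hb, map_add]⟩
  smul_mem' := by
    rintro c x ⟨a, ha⟩
    exact ⟨sigma p k c • a, by rw [smul_comm, ha, LinearMap.map_smulₛₗ]⟩

/-- The map `F/p : F¹_N(L) → L`; it is well defined as `L` has no `p`-torsion. -/
def divFrobenius : L.nygaard →+ L :=
  AddMonoidHom.mk' (fun x => x.2.choose) fun x y => p_smul_injective L <| by
    have h : (p : WittVector p k) • (x + y).2.choose = L.F (x + y : L.nygaard) :=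
      (x + y).2.choose_spec
    have hx : (p : WittVector p k) • x.2.choose = L.F x := x.2.choose_spec
    have hy : (p : WittVector p k) • y.2.choose = L.F y := y.2.choose_spec
    change (p : WittVector p k) • (x + y).2.choose =
      (p : WittVector p k) • (x.2.choose + y.2.choose)
    rw [smul_add, h, hx, hy, Submodule.coe_add, map_add]

theorem p_smul_divFrobenius (x : L.nygaard) :
    (p : WittVector p k) • L.divFrobenius x = L.F x :=
  x.2.choose_spec

/-- The homomorphism `F/p - 1 : F¹_N(L) → L`. -/
def divFrobeniusSubOne : L.nygaard →+ L :=
  L.divFrobenius - L.nygaard.toAddSubgroup.subtype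

/-- The algebra of regular functions on the pro-algebraic group `𝐋 ≅ 𝐖ⁿ`, whose group of
`k`-points is `L`. Pro-algebraic groups over the algebraically closed field `k` are taken in the
sense of Serre (perfections of group schemes), so an affine one is given by its group of `k`-points
and its `k`-algebra of regular functions, which is closed under `p`-th roots. For `𝐋` the
regular functions are the polynomials in the `p^m`-th roots of the Witt components of the linear
forms on `L`. In terms of a `W`-basis of `L`, these are the polynomials in the `p^m`-th roots of
the Witt components of the coordinates. -/
def regularFunctions : Subalgebra k (L → k) :=
  Algebra.adjoin k {g | ∃ (l : Module.Dual (WittVector p k) L) (n m : ℕ),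
    ∀ x, g x ^ p ^ m = (l x).coeff n}

/-- The group of `k`-points of `𝐔_L = Coker [F/p - 1 : F¹_N(𝐋) → 𝐋]`. -/
def U : Type v := L ⧸ L.divFrobeniusSubOne.range

instance : AddCommGroup L.U := inferInstanceAs (AddCommGroup (L ⧸ L.divFrobeniusSubOne.range))

/-- The projection `L → 𝐔_L(k)`. -/
def toU : L →+ L.U := QuotientAddGroup.mk' L.divFrobeniusSubOne.range

/-- The algebra of regular functions on `𝐔_L`. As for any quotient of an affine commutative group
by a closed subgroup, these are the functions on the quotient whose pull-back to `𝐋` is regular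
(equivalently, the regular functions on `𝐋` that are invariant under translations by the image of
`F/p - 1`). -/
def regularFunctionsU : Subalgebra k (L.U → k) :=
  L.regularFunctions.comap (AlgHom.pi fun x => Pi.evalAlgHom k (fun _ : L.U => k) (L.toU x))

theorem mem_regularFunctionsU (f : L.U → k) :
    f ∈ L.regularFunctionsU ↔ (fun x => f (L.toU x)) ∈ L.regularFunctions :=
  Iff.rfl

/-- The dimension of `𝐔_L`: the Krull dimension of its algebra of regular functions. -/
def dimU : WithBot ℕ∞ := ringKrullDim L.regularFunctionsU

end FCrystal

end Modules

end Dieudonne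

end

namespace Dieudonne

set_option linter.unusedSectionVars false

/-! ### Krull dimension under integral extensions -/

open Polynomial

/-! Compare two F-crystals by counting lengths. Write δ = F/p - 1, and let j : L' → L and j' : L →
L' commute with F, with composites p^N. Inside L, the group 𝐔_{L'} is the quotient of jL' by δ(j
F¹_N(L')). Enlarging jL' to L raises the dimension of the quotient by at least n = length(L / jL')
(`LatticeChain.ringKrullDim_add_le_map`); enlarging j F¹_N(L') to F¹_N(L) lowers it by at most m =
length(F¹_N(L) / j F¹_N(L')) (`FCrystal.ringKrullDim_imageSub_le`). Hence dim 𝐔_{L'} + n ≤ dim 𝐔_L +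
m. If L / F¹_N(L) and L' / F¹_N(L') have the same length, then m = n by Jordan–Hölder, so dim 𝐔_{L'}
≤ dim 𝐔_L, and symmetry gives equality (`FCrystal.dimU_eq_of_quasiIsogeny`).

For a general F-crystal the length of L / F¹_N(L) is not an isogeny invariant, and this is where
Dieudonné modules enter. Put F in diagonal form; the length is the number of unit diagonal entries
(`FCrystal.latticeChain_nygaard`). For M itself it is the length of M / VM, which is an isogeny
invariant because V is injective and commutes with isogenies. For M ⊗ N and ∧²M the number of units
is a product, respectively a binomial coefficient, of such invariants.

The dimension theory is done on algebras of functions. Finiteness holds because the image of F - p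
contains some p^n L (`exists_powSubgroup_le_range`), so only finitely many Witt components matter,
up to p-power roots. The upper bound comes from quotients by one-parameter subgroups t ↦ δ([t]e),
each of which lowers the dimension by at most one
(`IsOneParameter.almostFinite_and_ringKrullDim_le`). The lower bound comes from a regular function
on the larger lattice that is a nonzerodivisor and vanishes on the smaller one
(`ringKrullDim_succ_le_of_sublattice`). -/

theorem ringKrullDim_le_of_isIntegral (R S : Type*) [CommRing R] [CommRing S] [Algebra R S]
    [Algebra.IsIntegral R S] : ringKrullDim S ≤ ringKrullDim R :=
  Order.krullDim_le_of_strictMono (PrimeSpectrum.comap (algebraMap R S)) fun _ _ h =>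
    Ideal.IsIntegral.comap_lt_comap h

/-- Injectivity gives a prime over the head of any chain in the base, and going up lifts the rest of
the chain. -/
theorem ringKrullDim_eq_of_isIntegral (R S : Type*) [CommRing R] [CommRing S] [Algebra R S]
    [Algebra.IsIntegral R S] (hinj : Function.Injective (algebraMap R S)) :
    ringKrullDim S = ringKrullDim R := by
  refine le_antisymm (ringKrullDim_le_of_isIntegral R S) (iSup_le fun l => ?_)
  obtain ⟨P, -, hP, hPl⟩ := Ideal.exists_ideal_over_prime_of_isIntegral (S := S)
    l.head.asIdeal ⊥ (by
      rw [← RingHom.ker_eq_comap_bot, (RingHom.injective_iff_ker_eq_bot _).mp hinj]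
      exact bot_le)
  have : P.LiesOver l.head.asIdeal := ⟨hPl.symm⟩
  obtain ⟨L, hL, -⟩ := Ideal.exists_ltSeries_of_hasGoingUp l P
  rw [← hL]
  exact le_iSup (fun l : LTSeries (PrimeSpectrum S) => (l.length : WithBot ℕ∞)) L

/-! ### Algebras integral over a finitely generated subalgebra -/

section AlmostFinite

variable {k B : Type*} [Field k] [CommRing B] [Algebra k B]

/-- A subalgebra that is integral over one of its finitely generated subalgebras. -/
def AlmostFinite (A : Subalgebra k B) : Prop :=
  ∃ S ≤ A, S.FG ∧ ∀ a ∈ A, IsIntegral S a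

/-- `A` need not be Noetherian, since p-power roots are adjoined. Finiteness and the formula for the
polynomial ring are therefore transferred from the Noetherian subalgebra along the integral
extensions S ⊆ A and S[X] ⊆ A[X]. -/
theorem AlmostFinite.exists_ringKrullDim [Nontrivial B] {A : Subalgebra k B}
    (hA : AlmostFinite A) :
    ∃ d : ℕ, ringKrullDim A = d ∧ ringKrullDim A[X] = d + 1 := by
  obtain ⟨S, hSA, hS, hint⟩ := hA
  have hft : Algebra.FiniteType k S := (Subalgebra.fg_iff_finiteType S).mp hS
  have hnoeth : IsNoetherianRing S := Algebra.FiniteType.isNoetherianRing k S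
  let _ : Algebra S A := (Subalgebra.inclusion hSA).toAlgebra
  have hinj : Function.Injective (algebraMap S A) := Subalgebra.inclusion_injective hSA
  have : IsScalarTower S A B := IsScalarTower.of_algebraMap_eq fun _ => rfl
  have : Algebra.IsIntegral S A := ⟨fun a => by
    have h := hint a a.2
    exact (isIntegral_algHom_iff (IsScalarTower.toAlgHom S A B) Subtype.val_injective).mp h⟩
  have hdim : ∃ d : ℕ, ringKrullDim S = d := by
    obtain ⟨n, f, hf⟩ := Algebra.FiniteType.iff_quotient_mvPolynomial''.mp hft
    have h1 := ringKrullDim_le_of_surjective f.toRingHom hf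
    rw [MvPolynomial.ringKrullDim_of_isNoetherianRing, ringKrullDim_eq_zero_of_field] at h1
    have h0 : (0 : WithBot ℕ∞) ≤ ringKrullDim S := ringKrullDim_nonneg_of_nontrivial
    generalize ringKrullDim S = x at h0 h1
    rw [zero_add] at h1
    induction x with
    | bot => simp at h0
    | coe x =>
      induction x with
      | top => exact absurd h1 (by
          rw [not_le]; exact WithBot.coe_lt_coe.mpr (ENat.natCast_lt_top _))
      | coe d => exact ⟨d, rfl⟩
  obtain ⟨d, hd⟩ := hdim
  refine ⟨d, (ringKrullDim_eq_of_isIntegral S A hinj).trans hd, ?_⟩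
  rw [← hd, ← Polynomial.ringKrullDim_of_isNoetherianRing]
  let _ : Algebra S[X] A[X] := Polynomial.algebra S A
  have : Algebra.IsIntegral S[X] A[X] := ⟨fun f =>
    Polynomial.isIntegral_iff_isIntegral_coeff.mpr fun n => Algebra.IsIntegral.isIntegral _⟩
  exact ringKrullDim_eq_of_isIntegral S[X] A[X] (Polynomial.map_injective _ hinj)

theorem isIntegral_of_forall_mem_isIntegral {C T : Subalgebra k B}
    (hT : ∀ t ∈ T, IsIntegral C t) {x : B} (hx : IsIntegral T x) : IsIntegral C x := by
  let D : Subalgebra C B := integralClosure C B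
  have hD : IsIntegral D x := by
    obtain ⟨q, hq, hqx⟩ := hx
    let i : T →+* D :=
      { toFun := fun t => ⟨t, hT t t.2⟩
        map_one' := rfl
        map_mul' := fun _ _ => rfl
        map_zero' := rfl
        map_add' := fun _ _ => rfl }
    refine ⟨q.map i, hq.map i, ?_⟩
    rw [Polynomial.eval₂_map]
    exact hqx
  exact isIntegral_trans x hD

/-- If an endomorphism `f` of the ambient algebra fixes `R` and maps `A` to elements that are
integral over `R`, then `R` is almost finite when `A` is. -/
theorem AlmostFinite.of_algHom [Nontrivial B] {A R : Subalgebra k B} (hA : AlmostFinite A) (hRA : R ≤ A)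
    (f : B →ₐ[k] B) (hfix : ∀ r ∈ R, f r = r) (hf : ∀ a ∈ A, IsIntegral R (f a)) :
    AlmostFinite R := by
  classical
  obtain ⟨S, hSA, ⟨s, rfl⟩, hint⟩ := hA
  have hs : ∀ a : s, ∃ q : R[X], q.Monic ∧ q.eval₂ (algebraMap R B) (f a) = 0 :=
    fun a => hf a (hSA (Algebra.subset_adjoin a.2))
  choose q hq hq0 using hs
  -- As in the Artin–Tate lemma, the finitely generated subalgebra of `R` is generated by the
  -- coefficients of integral equations of the images of the generators.
  let c : Finset B := s.attach.biUnion fun a => (q a).support.image fun i => ((q a).coeff i : B)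
  have hcR : Algebra.adjoin k (c : Set B) ≤ R := by
    refine Algebra.adjoin_le fun x hx => ?_
    simp only [c, Finset.coe_biUnion, Set.mem_iUnion, Finset.coe_image, Set.mem_image] at hx
    obtain ⟨a, -, i, -, rfl⟩ := hx
    exact ((q a).coeff i).2
  set C := Algebra.adjoin k (c : Set B) with hC
  have hcoeff : ∀ a i, ((q a).coeff i : B) ∈ C := by
    intro a i
    by_cases hi : i ∈ (q a).support
    · refine Algebra.subset_adjoin ?_
      simp only [c, Finset.coe_biUnion, Set.mem_iUnion, Finset.coe_image, Set.mem_image]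
      exact ⟨a, by simp, i, hi, rfl⟩
    · rw [Polynomial.notMem_support_iff.mp hi]
      exact C.zero_mem
  have hfs : ∀ a : s, IsIntegral C (f a) := by
    intro a
    have hl : q a ∈ Polynomial.lifts (Subalgebra.inclusion hcR).toRingHom := by
      rw [Polynomial.lifts_iff_coeff_lifts]
      exact fun i => ⟨⟨_, hcoeff a i⟩, rfl⟩
    obtain ⟨q', hq', -, hm⟩ := Polynomial.lifts_and_degree_eq_and_monic hl (hq a)
    refine ⟨q', hm, ?_⟩
    rw [← hq0 a, ← hq', Polynomial.eval₂_map]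
    rfl
  have hT : ∀ t ∈ (Algebra.adjoin k (s : Set B)).map f, IsIntegral C t := by
    rw [AlgHom.map_adjoin]
    have : Algebra.adjoin k (f '' (s : Set B)) ≤ (integralClosure C B).restrictScalars k := by
      refine Algebra.adjoin_le ?_
      rintro _ ⟨a, ha, rfl⟩
      exact hfs ⟨a, ha⟩
    exact fun t ht => this ht
  refine ⟨C, hcR, ⟨c, rfl⟩, fun r hr => isIntegral_of_forall_mem_isIntegral hT ?_⟩
  -- Applying `f` to an integral equation of `r` over `S` gives one over f(S), because `f` fixes
  -- `r`.
  obtain ⟨u, hu, hur⟩ := hint r (hRA hr)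
  let i : Algebra.adjoin k (s : Set B) →+* (Algebra.adjoin k (s : Set B)).map f :=
    { toFun := fun t => ⟨f t, t, t.2, rfl⟩
      map_one' := Subtype.ext (map_one f)
      map_mul' := fun a b => Subtype.ext (map_mul f (a : B) b)
      map_zero' := Subtype.ext (map_zero f)
      map_add' := fun a b => Subtype.ext (map_add f (a : B) b) }
  refine ⟨u.map i, hu.map i, ?_⟩
  have h := congrArg f hur
  rw [map_zero, ← AlgHom.coe_toRingHom, Polynomial.hom_eval₂, AlgHom.coe_toRingHom,
    hfix r hr] at h
  rw [Polynomial.eval₂_map]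
  exact h

/-- If `A` is integral over a subalgebra `D` of `R[f]`, the dimension of `A` exceeds the dimension of `R` at most
by one. -/
theorem ringKrullDim_le_succ_of_isIntegral_adjoin [Nontrivial B] {A R : Subalgebra k B}
    (hR : AlmostFinite R) (hRA : R ≤ A) {f : B} (hf : f ∈ A)
    {D : Subalgebra k B} (hD : ∀ x ∈ D, ∃ q : R[X], Polynomial.aeval f q = x)
    (hint : ∀ a ∈ A, IsIntegral D a) :
    ringKrullDim A ≤ ringKrullDim R + 1 := by
  obtain ⟨d, hd, hd1⟩ := hR.exists_ringKrullDim
  rw [hd, ← hd1]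
  let φ : R[X] →+* A := Polynomial.eval₂RingHom (Subalgebra.inclusion hRA).toRingHom ⟨f, hf⟩
  let _ : Algebra R[X] A := φ.toAlgebra
  have hφ : ∀ q : R[X], (φ q : B) = Polynomial.aeval f q := by
    intro q
    simp only [φ, Polynomial.coe_eval₂RingHom, Polynomial.aeval_def]
    exact Polynomial.hom_eval₂ q _ A.val.toRingHom _
  have : Algebra.IsIntegral R[X] A := ⟨fun a => by
    obtain ⟨u, hu, hua⟩ := hint a a.2
    have hl : u.map (algebraMap _ B) ∈ Polynomial.lifts (A.val.toRingHom.comp φ) := by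
      rw [Polynomial.lifts_iff_coeff_lifts]
      intro i
      rw [Polynomial.coeff_map]
      obtain ⟨q, hq⟩ := hD _ (u.coeff i).2
      exact ⟨q, (hφ q).trans hq⟩
    obtain ⟨v, hv, -, hvm⟩ := Polynomial.lifts_and_degree_eq_and_monic hl (hu.map _)
    refine ⟨v, hvm, Subtype.val_injective ?_⟩
    have h1 : v.eval₂ (A.val.toRingHom.comp φ) (a : B) = 0 := by
      rw [← Polynomial.eval_map, hv, Polynomial.eval_map]
      exact hua
    exact (Polynomial.hom_eval₂ v _ A.val.toRingHom _).trans h1⟩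
  exact ringKrullDim_le_of_isIntegral R[X] A

end AlmostFinite

/-! ### Functions invariant under a one-parameter subgroup: additive functions -/

section Eval

variable {k : Type*} [Field k] {G : Type*}

/-- Evaluation of the members of an algebra of functions at a point. -/
def evalAt (A : Subalgebra k (G → k)) (x : G) : A →+* k :=
  (Pi.evalRingHom (fun _ => k) x).comp A.val.toRingHom

@[simp]
theorem evalAt_apply (A : Subalgebra k (G → k)) (x : G) (f : A) :
    evalAt A x f = (f : G → k) x := rfl

end Eval

section OneParameter

variable {p : ℕ} [Fact p.Prime] {k : Type*} [Field k] [CharP k p]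
  {G : Type*} [AddCommGroup G]

/-- The translation operator `f ↦ f (· + w)`. -/
def translation (k : Type*) [Field k] {G : Type*} [AddCommGroup G] (w : G) :
    Module.End k (G → k) :=
  LinearMap.funLeft k k (· + w)

@[simp]
theorem translation_apply (w x : G) (f : G → k) : translation k w f x = f (x + w) := rfl

theorem translation_pow (w : G) (n : ℕ) : translation k w ^ n = translation k (n • w) := by
  induction n with
  | zero => ext; simp
  | succ n ih =>
    rw [pow_succ, ih]
    ext f x
    simp [succ_nsmul, add_assoc]

/-- The functions in `A` that are invariant under translation by the points `θ t`. -/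
def thetaInvariants (A : Subalgebra k (G → k)) (θ : k → G) : Subalgebra k (G → k) where
  carrier := {f | f ∈ A ∧ ∀ t x, f (x + θ t) = f x}
  mul_mem' hf hg := ⟨A.mul_mem hf.1 hg.1, fun t x => by simp [hf.2 t x, hg.2 t x]⟩
  add_mem' hf hg := ⟨A.add_mem hf.1 hg.1, fun t x => by simp [hf.2 t x, hg.2 t x]⟩
  algebraMap_mem' c := ⟨A.algebraMap_mem c, fun t x => by simp⟩

/-- Conditions under which `θ` induces a one-parameter subgroup of the unipotent group with
algebra of functions `A`. -/
structure IsOneParameter (p : ℕ) {k : Type*} [Field k] {G : Type*} [AddCommGroup G]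
    (A : Subalgebra k (G → k)) (θ : k → G) : Prop where
  translate : ∀ f ∈ A, ∀ w, translation k w f ∈ A
  root : ∀ f : G → k, f ^ p ∈ A → f ∈ A
  family : ∀ f ∈ A, ∃ m, ∃ Q : A[X], ∀ x t, f (x + θ t) ^ p ^ m = Q.eval₂ (evalAt A x) t
  map_add : ∀ f ∈ A, ∀ x s t, f (x + θ (s + t)) = f (x + θ s + θ t)
  finite : ∀ f ∈ A, ∃ V : Submodule k (G → k), FiniteDimensional k V ∧
    ∀ w, translation k w f ∈ V
  torsion : ∃ n, ∀ f ∈ A, ∀ w x, f (x + p ^ n • w) = f x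

namespace IsOneParameter

variable {A : Subalgebra k (G → k)} {θ : k → G}

theorem map_zero (h : IsOneParameter p A θ) {f : G → k} (hf : f ∈ A) (x : G) : f (x + θ 0) = f x := by
  have := h.map_add f hf (x - θ 0) 0 0
  simpa using this.symm

/-- Unipotence. Choose a non-invariant `f` whose translates span a space T of least dimension. If D
= translation - 1 sent `f` to another non-invariant function, minimality would force D(T) = T; but
D^(p^n) is translation by p^n w minus the identity, which kills T by the torsion condition. -/
theorem exists_difference_mem (h : IsOneParameter p A θ) (hA : ¬ A ≤ thetaInvariants A θ) :
    ∃ f ∈ A, f ∉ thetaInvariants A θ ∧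
      ∀ w, translation k w f - f ∈ thetaInvariants A θ := by
  classical
  let T : (G → k) → Submodule k (G → k) :=
    fun f => Submodule.span k (Set.range fun w => translation k w f)
  have hT : ∀ f ∈ A, FiniteDimensional k (T f) := fun f hf => by
    obtain ⟨V, hV, hVf⟩ := h.finite f hf
    exact Submodule.finiteDimensional_of_le (Submodule.span_le.mpr (by
      rintro _ ⟨w, rfl⟩
      exact hVf w) : T f ≤ V)
  obtain ⟨f₀, hf₀, hf₀'⟩ := SetLike.not_le_iff_exists.mp hA
  have hne : ∃ n, ∃ f ∈ A, f ∉ thetaInvariants A θ ∧ Module.finrank k (T f) = n :=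
    ⟨_, f₀, hf₀, hf₀', rfl⟩
  obtain ⟨f, hf, hfR, hfn⟩ := Nat.find_spec hne
  refine ⟨f, hf, hfR, fun w => ?_⟩
  by_contra hw
  have hDA : translation k w f - f ∈ A := A.sub_mem (h.translate f hf w) hf
  have hmin : Module.finrank k (T f) ≤ Module.finrank k (T (translation k w f - f)) := by
    rw [hfn]
    exact Nat.find_min' hne ⟨_, hDA, hw, rfl⟩
  set D : Module.End k (G → k) := translation k w - 1 with hD
  have hTD : T (translation k w f - f) ≤ (T f).map D := by
    refine Submodule.span_le.mpr ?_
    rintro _ ⟨v, rfl⟩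
    refine ⟨translation k v f, Submodule.subset_span ⟨v, rfl⟩, ?_⟩
    ext x
    simp [hD, add_right_comm]
  have hDT : (T f).map D ≤ T f := by
    rw [Submodule.map_le_iff_le_comap]
    refine Submodule.span_le.mpr ?_
    rintro _ ⟨v, rfl⟩
    have hvw : translation k (v + w) f ∈ T f := Submodule.subset_span ⟨v + w, rfl⟩
    have hv : translation k v f ∈ T f := Submodule.subset_span ⟨v, rfl⟩
    have hx : D (translation k v f) = translation k (v + w) f - translation k v f := by
      ext x
      simp [hD, add_assoc, add_comm w]
    change D (translation k v f) ∈ T f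
    rw [hx]
    exact Submodule.sub_mem _ hvw hv
  have := hT f hf
  have heq : (T f).map D = T f := by
    have h1 : T (translation k w f - f) = T f :=
      Submodule.eq_of_le_of_finrank_le (hTD.trans hDT) hmin
    exact le_antisymm hDT (h1 ▸ hTD)
  have hpow : ∀ n, (T f).map (D ^ n) = T f := by
    intro n
    induction n with
    | zero => exact Submodule.map_id _
    | succ n ih => rw [pow_succ, Module.End.mul_eq_comp, Submodule.map_comp, heq, ih]
  obtain ⟨n, hn⟩ := h.torsion
  have : CharP (Module.End k (G → k)) p :=
    charP_of_injective_algebraMap (FaithfulSMul.algebraMap_injective k _) p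
  have hDn : D ^ p ^ n = translation k (p ^ n • w) - 1 := by
    rw [hD, sub_pow_char_pow_of_commute _ _ (Commute.one_right _), one_pow, translation_pow]
  have hTA : T f ≤ Subalgebra.toSubmodule A := by
    refine Submodule.span_le.mpr ?_
    rintro _ ⟨v, rfl⟩
    exact h.translate f hf v
  have hzero : (T f).map (D ^ p ^ n) ≤ ⊥ := by
    rintro _ ⟨g, hg, rfl⟩
    rw [hDn, Submodule.mem_bot]
    ext x
    simp [hn g (hTA hg) w x]
  rw [hpow, le_bot_iff] at hzero
  have hf0 : f ∈ T f := Submodule.subset_span ⟨0, by ext; simp⟩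
  rw [hzero, Submodule.mem_bot] at hf0
  exact hfR (hf0 ▸ (thetaInvariants A θ).zero_mem)

/-- If every translate of `f` differs from `f` by an invariant, then f(x + θ t) - f(x) does not
depend on `x`. Passing to a p-power makes this difference polynomial in `t`. -/
theorem exists_additive (h : IsOneParameter p A θ) (hA : ¬ A ≤ thetaInvariants A θ) :
    ∃ f ∈ A, ∃ C : k[X], C ≠ 0 ∧ ∀ x t, f (x + θ t) = f x + C.eval t := by
  obtain ⟨f, hf, hfR, hd⟩ := h.exists_difference_mem hA
  have hadd : ∀ x t, f (x + θ t) = f x + (f (θ t) - f 0) := by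
    intro x t
    have := (hd x).2 t 0
    simp only [Pi.sub_apply, translation_apply, zero_add] at this
    rw [add_comm x, ← sub_add_cancel (f (θ t + x)) (f (θ t)), this]
    ring
  obtain ⟨m, Q, hQ⟩ := h.family f hf
  refine ⟨f ^ p ^ m, A.pow_mem hf _, Q.map (evalAt A 0) - Polynomial.C (f 0 ^ p ^ m), ?_, ?_⟩
  · intro h0
    refine hfR ⟨hf, fun t x => ?_⟩
    have h1 := congrArg (Polynomial.eval t) h0
    rw [Polynomial.eval_sub, Polynomial.eval_map, ← hQ, Polynomial.eval_C, Polynomial.eval_zero,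
      ← sub_pow_char_pow, zero_add] at h1
    rw [hadd x t, eq_zero_of_pow_eq_zero h1, add_zero]
  · intro x t
    rw [Polynomial.eval_sub, Polynomial.eval_map, ← hQ, Polynomial.eval_C, ← sub_pow_char_pow,
      zero_add, Pi.pow_apply, Pi.pow_apply, hadd x t, add_pow_char_pow]

theorem eval_add (h : IsOneParameter p A θ) {f : G → k} (hf : f ∈ A) {C : k[X]} (hC : ∀ x t, f (x + θ t) = f x + C.eval t)
    (s t : k) : C.eval (s + t) = C.eval s + C.eval t := by
  have := h.map_add f hf 0 s t
  rw [hC, hC, hC] at this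
  linear_combination this

/-- Take C of least degree. An additive polynomial has constant derivative; were it zero, C would be
the p-th power of an additive polynomial of smaller degree, realised by the p-th root of `f`, which
also lies in `A`. -/
theorem exists_separable_additive [IsAlgClosed k] (h : IsOneParameter p A θ)
    (hA : ¬ A ≤ thetaInvariants A θ) :
    ∃ f ∈ A, ∃ C : k[X], C.Monic ∧ 0 < C.natDegree ∧
      (∀ x t, f (x + θ t) = f x + C.eval t) ∧ ∃ a : k, a ≠ 0 ∧ derivative C = Polynomial.C a := by
  classical
  have hne : ∃ n, ∃ f ∈ A, ∃ C : k[X], C ≠ 0 ∧ (∀ x t, f (x + θ t) = f x + C.eval t) ∧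
      C.natDegree = n := by
    obtain ⟨f, hf, C, hC, hfC⟩ := h.exists_additive hA
    exact ⟨_, f, hf, C, hC, hfC, rfl⟩
  obtain ⟨f, hf, C, hC0, hfC, hn⟩ := Nat.find_spec hne
  have hadd := h.eval_add hf hfC
  have hC00 : C.eval 0 = 0 := by simpa using hadd 0 0
  have hdeg : 0 < C.natDegree := by
    rw [Nat.pos_iff_ne_zero]
    intro h0
    rw [Polynomial.natDegree_eq_zero] at h0
    obtain ⟨c, rfl⟩ := h0
    simp only [Polynomial.eval_C] at hC00
    exact hC0 (by rw [hC00, Polynomial.C_0])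
  have hder : ∀ s, (derivative C).eval s = (derivative C).eval 0 := by
    intro s
    have h1 : C.comp (X + Polynomial.C s) = C + Polynomial.C (C.eval s) :=
      Polynomial.funext fun t => by simp [hadd]
    have h2 := congrArg (fun q => (derivative q).eval 0) h1
    simpa [Polynomial.derivative_comp] using h2
  have hder' : derivative C = Polynomial.C ((derivative C).eval 0) :=
    Polynomial.funext fun s => by rw [hder s, Polynomial.eval_C]
  have hane : (derivative C).eval 0 ≠ 0 := by
    intro ha
    rw [ha, Polynomial.C_0] at hder'
    have hexp := Polynomial.expand_contract p hder' (Fact.out : p.Prime).ne_zero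
    -- The coefficients of the contraction are replaced by their p-th roots, so that D(t)^p = C(t).
    let D := (contract p C).map ((frobeniusEquiv k p).symm : k →+* k)
    have hD : ∀ t, D.eval t ^ p = C.eval t := by
      intro t
      rw [← hexp, Polynomial.expand_eval]
      have h1 : ((frobeniusEquiv k p).symm : k →+* k) (t ^ p) = t :=
        (frobeniusEquiv k p).symm_apply_apply t
      have h2 : D.eval t = ((frobeniusEquiv k p).symm : k →+* k) ((contract p C).eval (t ^ p)) := by
        rw [← Polynomial.eval_map_apply, h1]
      rw [h2]
      exact (frobeniusEquiv k p).apply_symm_apply _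
    have hlt : D.natDegree < C.natDegree := by
      have h1 : D.natDegree = (contract p C).natDegree :=
        Polynomial.natDegree_map_eq_of_injective (RingHom.injective _) _
      have h2 : C.natDegree = (contract p C).natDegree * p := by
        conv_lhs => rw [← hexp, Polynomial.natDegree_expand]
      have hp := (Fact.out : p.Prime).one_lt
      rw [h1]
      rw [h2] at hdeg ⊢
      exact lt_mul_of_one_lt_right (Nat.pos_of_mul_pos_right hdeg) hp
    let g : G → k := fun x => (frobeniusEquiv k p).symm (f x)
    have hg : ∀ x, g x ^ p = f x := fun x => (frobeniusEquiv k p).apply_symm_apply (f x)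
    refine Nat.find_min hne (hn ▸ hlt) ⟨g, h.root g ?_, D, ?_, fun x t => ?_, rfl⟩
    · rw [show g ^ p = f from funext hg]
      exact hf
    · intro h0
      refine hC0 (Polynomial.funext fun t => ?_)
      rw [← hD, h0, Polynomial.eval_zero, _root_.zero_pow (Fact.out : p.Prime).ne_zero]
    · apply frobenius_inj k p
      rw [_root_.map_add, frobenius_def, frobenius_def, frobenius_def, hg, hg, hD, hfC]
  have hlc : C.leadingCoeff ≠ 0 := Polynomial.leadingCoeff_ne_zero.mpr hC0
  refine ⟨C.leadingCoeff⁻¹ • f, A.smul_mem hf _, C * Polynomial.C C.leadingCoeff⁻¹,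
    Polynomial.monic_mul_leadingCoeff_inv hC0, ?_, fun x t => ?_,
    (derivative C).eval 0 * C.leadingCoeff⁻¹, mul_ne_zero hane (inv_ne_zero hlc), ?_⟩
  · rwa [Polynomial.natDegree_mul_C (inv_ne_zero hlc)]
  · simp only [Pi.smul_apply, smul_eq_mul, hfC, Polynomial.eval_mul, Polynomial.eval_C]
    ring
  · rw [Polynomial.derivative_mul, Polynomial.derivative_C, mul_zero, add_zero,
      Polynomial.C_mul, ← hder']

end IsOneParameter

end OneParameter

/-! ### A multivalued slice of the one-parameter subgroup and the dimension bound -/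

section OneParameter

variable {p : ℕ} [Fact p.Prime] {k : Type*} [Field k] [CharP k p]
  {G : Type*} [AddCommGroup G]

namespace IsOneParameter

variable {A : Subalgebra k (G → k)} {θ : k → G}

/-- Composition with the map `x ↦ x + θ (τ x)`. -/
def shift (θ : k → G) (τ : G → k) : (G → k) →ₐ[k] (G → k) :=
  AlgHom.pi fun x => Pi.evalAlgHom k (fun _ => k) (x + θ (τ x))

@[simp]
theorem shift_apply (θ : k → G) (τ : G → k) (g : G → k) (x : G) :
    shift θ τ g x = g (x + θ (τ x)) := rfl

theorem shift_eq_self {τ : G → k} {r : G → k} (hr : r ∈ thetaInvariants A θ) :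
    shift θ τ r = r := funext fun _ => hr.2 _ _

/-- A function that is a polynomial in `T` over `A` taking the same value at all roots `T` of the
separable polynomial `C + f x` lies in `A`. -/
theorem mem_of_eval₂_root_eq {f : G → k} (hf : f ∈ A) {C : k[X]} (hC : C.Monic)
    (hdeg : 0 < C.natDegree) {v : G → k} (q : A[X]) (Γ : G → Finset k)
    (hΓ : ∀ x, (Γ x).card = C.natDegree) (hroot : ∀ x, ∀ t ∈ Γ x, C.eval t = -f x)
    (hv : ∀ x, ∀ t ∈ Γ x, q.eval₂ (evalAt A x) t = v x) : v ∈ A := by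
  let m : A[X] := C.map (algebraMap k A) + Polynomial.C ⟨f, hf⟩
  have hCm : (C.map (algebraMap k A)).Monic := hC.map _
  have hCd : (C.map (algebraMap k A)).natDegree = C.natDegree := hC.natDegree_map _
  have hlt : (Polynomial.C (⟨f, hf⟩ : A)).degree < (C.map (algebraMap k A)).degree := by
    refine lt_of_le_of_lt Polynomial.degree_C_le ?_
    rw [Polynomial.degree_eq_natDegree hCm.ne_zero, hCd]
    exact_mod_cast hdeg
  have hm : m.Monic := hCm.add_of_left hlt
  have hmd : m.natDegree = C.natDegree := by
    rw [← hCd]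
    exact Polynomial.natDegree_add_eq_left_of_degree_lt hlt
  have hmev : ∀ x t, m.eval₂ (evalAt A x) t = C.eval t + f x := by
    intro x t
    rw [Polynomial.eval₂_add, Polynomial.eval₂_map, Polynomial.eval₂_C]
    rfl
  -- The remainder has degree less than deg C and is constant on deg C distinct points, so it is
  -- constant.
  have hkey : ∀ x, (q %ₘ m).map (evalAt A x) = Polynomial.C (v x) := by
    intro x
    refine Polynomial.eq_of_degree_sub_lt_of_eval_finset_eq (Γ x) ?_ fun t ht => ?_
    · rw [hΓ]
      refine lt_of_le_of_lt (Polynomial.degree_sub_le _ _) (max_lt ?_ ?_)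
      · refine lt_of_le_of_lt Polynomial.degree_map_le ?_
        rw [← hmd, ← Polynomial.degree_eq_natDegree hm.ne_zero]
        exact Polynomial.degree_modByMonic_lt q hm
      · exact lt_of_le_of_lt Polynomial.degree_C_le (by exact_mod_cast hdeg)
    · rw [Polynomial.eval_C, ← hv x t ht, Polynomial.eval_map]
      conv_rhs => rw [← Polynomial.modByMonic_add_div q m]
      rw [Polynomial.eval₂_add, Polynomial.eval₂_mul, hmev, hroot x t ht]
      ring
  have : v = ((q %ₘ m).coeff 0 : A) := by
    ext x
    have h1 := congrArg (fun u => u.coeff 0) (hkey x)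
    simp only [Polynomial.coeff_map, Polynomial.coeff_C_zero] at h1
    exact h1.symm
  rw [this]
  exact ((q %ₘ m).coeff 0).2

/-- A nonzero constant derivative makes every C + b separable. -/
theorem card_roots_add_C [IsAlgClosed k] {C : k[X]}
    (hder : ∃ a : k, a ≠ 0 ∧ derivative C = Polynomial.C a) (hdeg : 0 < C.natDegree) (b : k) :
    ∃ Γ : Finset k, Γ.card = C.natDegree ∧ ∀ t, t ∈ Γ ↔ C.eval t = -b := by
  classical
  obtain ⟨a, ha, hder⟩ := hder
  have hm : (C + Polynomial.C b).natDegree = C.natDegree := Polynomial.natDegree_add_C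
  have h0 : C + Polynomial.C b ≠ 0 := by
    intro h0
    rw [h0, Polynomial.natDegree_zero] at hm
    omega
  have hsep : (C + Polynomial.C b).Separable := by
    rw [Polynomial.separable_def, Polynomial.derivative_add, hder, Polynomial.derivative_C,
      add_zero]
    exact (isCoprime_one_right.of_isCoprime_of_dvd_right
      ((Polynomial.isUnit_C.mpr (isUnit_iff_ne_zero.mpr ha)).dvd))
  refine ⟨(C + Polynomial.C b).roots.toFinset, ?_, fun t => ?_⟩
  · rw [Multiset.toFinset_card_of_nodup (Polynomial.nodup_roots hsep), ← hm]
    exact ((IsAlgClosed.splits _).natDegree_eq_card_roots).symm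
  · rw [Multiset.mem_toFinset, Polynomial.mem_roots h0, Polynomial.IsRoot.def,
      Polynomial.eval_add, Polynomial.eval_C, eq_neg_iff_add_eq_zero]

/-- The coefficients of `∏ (X - Q (t + γ))` depend polynomially on `t`. -/
theorem exists_coeff_prod_X_sub_C {k R : Type*} [Field k] [CommRing R] [Algebra k R] (Q : R[X])
    (Γ : Finset k) (i : ℕ) : ∃ q : R[X], ∀ φ : R →+* k, (∀ c, φ (algebraMap k R c) = c) →
      ∀ t, q.eval₂ φ t = (∏ γ ∈ Γ, (X - Polynomial.C (Q.eval₂ φ (t + γ)))).coeff i := by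
  let P : R[X][X] := ∏ γ ∈ Γ, (X - Polynomial.C (Q.comp (X + Polynomial.C (algebraMap k R γ))))
  refine ⟨P.coeff i, fun φ hφ t => ?_⟩
  have hP : P.map (Polynomial.eval₂RingHom φ t) =
      ∏ γ ∈ Γ, (X - Polynomial.C (Q.eval₂ φ (t + γ))) := by
    rw [Polynomial.map_prod]
    refine Finset.prod_congr rfl fun γ _ => ?_
    rw [Polynomial.map_sub, Polynomial.map_X, Polynomial.map_C, Polynomial.coe_eval₂RingHom,
      Polynomial.eval₂_comp, Polynomial.eval₂_add, Polynomial.eval₂_X, Polynomial.eval₂_C, hφ]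
  rw [← hP, Polynomial.coeff_map]
  rfl

/-- The slice point x + θ(τ x) is one of deg C candidates, one for each root t of C = -f(x). The
product of X - g(x + θ t) over all roots is monic and vanishes at the shifted function. Moving x by
θ s translates the root set by -s, so its coefficients are invariant; they lie in `A` by
`mem_of_eval₂_root_eq`, being polynomial in any one root with a value independent of the root. -/
theorem isIntegral_shift [IsAlgClosed k] (h : IsOneParameter p A θ) {f : G → k} (hf : f ∈ A)
    {C : k[X]} (hC : C.Monic) (hdeg : 0 < C.natDegree)
    (hfC : ∀ x t, f (x + θ t) = f x + C.eval t)
    (hder : ∃ a : k, a ≠ 0 ∧ derivative C = Polynomial.C a) {τ : G → k}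
    (hτ : ∀ x, C.eval (τ x) = -f x) {g : G → k} (hg : g ∈ A) :
    IsIntegral (thetaInvariants A θ) (shift θ τ g) := by
  classical
  obtain ⟨m, Q, hQ⟩ := h.family g hg
  refine IsIntegral.of_pow (pow_pos (Fact.out : p.Prime).pos m) ?_
  rw [← map_pow]
  replace hg : g ^ p ^ m ∈ A := A.pow_mem hg _
  replace hQ : ∀ x t, (g ^ p ^ m) (x + θ t) = Q.eval₂ (evalAt A x) t := hQ
  generalize g ^ p ^ m = g at hg hQ
  have hadd := h.eval_add hf hfC
  have hneg : ∀ t, C.eval (-t) = -C.eval t := by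
    intro t
    have h0 : C.eval 0 = 0 := by simpa using hadd 0 0
    have h1 := hadd t (-t)
    rw [add_neg_cancel, h0] at h1
    linear_combination -h1
  choose Γ hΓcard hΓ using card_roots_add_C hder hdeg
  have hN : ∀ x, ∃ N : k[X], N = ∏ t ∈ Γ (f x), (X - Polynomial.C (g (x + θ t))) :=
    fun x => ⟨_, rfl⟩
  choose N hN using hN
  -- the value of `N` in terms of a fixed root
  have hshift : ∀ x t₀, C.eval t₀ = -f x →
      N x = ∏ γ ∈ Γ 0, (X - Polynomial.C (g (x + θ (t₀ + γ)))) := by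
    intro x t₀ ht₀
    rw [hN]
    refine (Finset.prod_bij (fun γ _ => t₀ + γ) (fun γ hγ => ?_)
      (fun _ _ _ _ h => add_left_cancel h) (fun t ht => ?_) (fun _ _ => rfl)).symm
    · rw [hΓ, hadd, ht₀, (hΓ 0 γ).mp hγ, neg_zero, add_zero]
    · refine ⟨t - t₀, ?_, add_sub_cancel _ _⟩
      rw [hΓ, sub_eq_add_neg, hadd, hneg, ht₀, (hΓ _ t).mp ht]
      simp
  have hNmonic : ∀ x, (N x).Monic := fun x => by
    rw [hN]
    exact Polynomial.monic_prod_of_monic _ _ fun _ _ => Polynomial.monic_X_sub_C _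
  have hNdeg : ∀ x, (N x).natDegree = C.natDegree := fun x => by
    rw [hN, Polynomial.natDegree_prod_of_monic _ _ fun _ _ => Polynomial.monic_X_sub_C _]
    simp [hΓcard]
  have hNinv : ∀ x s, N (x + θ s) = N x := by
    intro x s
    have h1 : C.eval (s + τ (x + θ s)) = -f x := by
      rw [hadd, hτ, hfC]
      ring
    rw [hshift x _ h1, hshift _ _ (hτ (x + θ s))]
    refine Finset.prod_congr rfl fun γ _ => ?_
    rw [add_assoc s, h.map_add g hg x s]
  have hP : ∀ i, ∃ q : A[X], ∀ x t, C.eval t = -f x →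
      q.eval₂ (evalAt A x) t = (N x).coeff i := by
    intro i
    obtain ⟨q, hq⟩ := exists_coeff_prod_X_sub_C (k := k) Q (Γ 0) i
    refine ⟨q, fun x t ht => ?_⟩
    rw [hshift x t ht, hq (evalAt A x) (fun _ => rfl)]
    simp only [hQ]
  have hv : ∀ i, (fun x => (N x).coeff i) ∈ thetaInvariants A θ := by
    intro i
    obtain ⟨q, hq⟩ := hP i
    refine ⟨mem_of_eval₂_root_eq hf hC hdeg q (fun x => Γ (f x)) (fun x => hΓcard _)
      (fun x t ht => (hΓ _ t).mp ht) fun x t ht => hq x t ((hΓ _ t).mp ht), fun t x => ?_⟩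
    simp only [hNinv]
  let u : (thetaInvariants A θ)[X] := X ^ C.natDegree +
    ∑ i ∈ Finset.range C.natDegree, Polynomial.C ⟨_, hv i⟩ * X ^ i
  refine ⟨u, ?_, ?_⟩
  · refine Polynomial.monic_X_pow_add ?_
    refine lt_of_le_of_lt (Polynomial.degree_sum_le _ _) ?_
    rw [Finset.sup_lt_iff (WithBot.bot_lt_coe _)]
    intro i hi
    refine lt_of_le_of_lt (Polynomial.degree_C_mul_X_pow_le _ _) ?_
    exact_mod_cast Finset.mem_range.mp hi
  · ext x
    have h1 : (N x).eval (g (x + θ (τ x))) = 0 := by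
      rw [hN, Polynomial.eval_prod]
      exact Finset.prod_eq_zero ((hΓ _ _).mpr (hτ x)) (by simp)
    rw [(hNmonic x).as_sum, hNdeg] at h1
    simp only [Polynomial.eval_add, Polynomial.eval_pow, Polynomial.eval_X,
      Polynomial.eval_finsetSum, Polynomial.eval_mul, Polynomial.eval_C] at h1
    simp only [u, Polynomial.eval₂_add, Polynomial.eval₂_pow, Polynomial.eval₂_X,
      Polynomial.eval₂_finsetSum, Polynomial.eval₂_mul, Polynomial.eval₂_C, Pi.add_apply,
      Pi.pow_apply, Finset.sum_apply, Pi.mul_apply, shift_apply, Pi.zero_apply]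
    exact h1

/-- The algebra of functions of a quotient by a one-parameter subgroup. -/
theorem almostFinite_and_ringKrullDim_le [IsAlgClosed k] (h : IsOneParameter p A θ)
    (hA : AlmostFinite A) :
    AlmostFinite (thetaInvariants A θ) ∧
      ringKrullDim A ≤ ringKrullDim (thetaInvariants A θ) + 1 := by
  have hle : thetaInvariants A θ ≤ A := fun f hf => hf.1
  by_cases hAR : A ≤ thetaInvariants A θ
  · rw [← le_antisymm hAR hle]
    refine ⟨hA, ?_⟩
    obtain ⟨d, hd, -⟩ := hA.exists_ringKrullDim
    rw [hd]
    exact_mod_cast Nat.le_succ d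
  obtain ⟨f, hf, C, hC, hdeg, hfC, hder⟩ := h.exists_separable_additive hAR
  have hτ : ∀ x, ∃ t, C.eval t = -f x := by
    intro x
    obtain ⟨Γ, hΓ, hmem⟩ := card_roots_add_C hder hdeg (f x)
    obtain ⟨t, ht⟩ := Finset.card_pos.mp (hΓ ▸ hdeg)
    exact ⟨t, (hmem t).mp ht⟩
  choose τ hτ using hτ
  have hint : ∀ g ∈ A, IsIntegral (thetaInvariants A θ) (shift θ τ g) := fun g hg =>
    h.isIntegral_shift hf hC hdeg hfC hder hτ hg
  have hR := hA.of_algHom hle (shift θ τ) (fun r hr => shift_eq_self hr) hint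
  refine ⟨hR, ?_⟩
  -- `D` is R[f] for R the algebra of invariants. The choice τ of a root need not be regular, but it
  -- is integral over `D` since C(τ) = -f.
  let D : Subalgebra k (G → k) :=
    (Polynomial.aeval (R := thetaInvariants A θ) f).range.restrictScalars k
  refine ringKrullDim_le_succ_of_isIntegral_adjoin hR hle hf (D := D) (fun x hx => hx) ?_
  have hfD : f ∈ D := ⟨X, Polynomial.aeval_X f⟩
  have hRD : ∀ x, IsIntegral (thetaInvariants A θ) x → IsIntegral D x := fun x hx =>
    isIntegral_of_forall_mem_isIntegral (fun r hr =>
      isIntegral_algebraMap (R := D) (x := ⟨r, Polynomial.C ⟨r, hr⟩, Polynomial.aeval_C _ _⟩)) hx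
  have hτint : IsIntegral D τ := by
    refine ⟨C.map (algebraMap k D) + Polynomial.C ⟨f, hfD⟩, ?_, ?_⟩
    · refine (hC.map _).add_of_left (lt_of_le_of_lt Polynomial.degree_C_le ?_)
      rw [Polynomial.degree_eq_natDegree (hC.map _).ne_zero, hC.natDegree_map]
      exact_mod_cast hdeg
    · rw [Polynomial.eval₂_add, Polynomial.eval₂_map, Polynomial.eval₂_C]
      ext x
      have h1 : C.eval₂ ((algebraMap D (G → k)).comp (algebraMap k D)) τ x = C.eval (τ x) := by
        have := Polynomial.hom_eval₂ C ((algebraMap D (G → k)).comp (algebraMap k D))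
          (Pi.evalRingHom (fun _ => k) x) τ
        exact this
      rw [Pi.add_apply, h1, hτ]
      exact neg_add_cancel _
  intro g hg
  obtain ⟨m, Q, hQ⟩ := h.family g hg
  refine IsIntegral.of_pow (pow_pos (Fact.out : p.Prime).pos m) ?_
  -- Moving back from the slice point x + θ(τ x) by the parameter -τ x expresses g^(p^m) through
  -- slice values, which are integral over the invariants, and powers of τ.
  have hsum : g ^ p ^ m = ∑ i ∈ Q.support, shift θ τ (Q.coeff i) * (-τ) ^ i := by
    ext x
    have h1 := hQ (x + θ (τ x)) (-τ x)
    rw [← h.map_add g hg, add_neg_cancel, h.map_zero hg, Polynomial.eval₂_eq_sum,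
      Polynomial.sum_def] at h1
    simpa using h1
  rw [hsum]
  exact IsIntegral.sum _ fun i _ => (hRD _ (hint _ (Q.coeff i).2)).mul (hτint.neg.pow i)

end IsOneParameter

end OneParameter

/-! ### Regular functions on lattices over the Witt vectors -/

section WittFunctions

variable {p : ℕ} [Fact p.Prime] {k : Type*} [Field k] [IsAlgClosed k] [CharP k p]

/-- A map to the Witt vectors all of whose components lie in a given algebra of functions. -/
def WittRegular {X : Type*} (S : Subalgebra k (X → k)) (a : X → WittVector p k) : Prop :=
  ∀ n, (fun x => (a x).coeff n) ∈ S

namespace WittRegular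

variable {X : Type*} {S : Subalgebra k (X → k)} {a b : X → WittVector p k}

/-- A family with components in `S` is a single Witt vector over `S`; closure under the ring
operations then follows from functoriality of Witt vectors, without the Witt polynomials. -/
theorem iff_exists_map :
    WittRegular S a ↔ ∃ α : WittVector p S, ∀ x, WittVector.map (evalAt S x) α = a x := by
  constructor
  · intro h
    refine ⟨WittVector.mk p fun n => ⟨_, h n⟩, fun x => ?_⟩
    ext n
    rfl
  · rintro ⟨α, hα⟩ n
    convert (α.coeff n).2 using 1
    ext x
    rw [← hα x]
    rfl

theorem add (ha : WittRegular S a) (hb : WittRegular S b) : WittRegular S fun x => a x + b x := by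
  obtain ⟨α, hα⟩ := iff_exists_map.mp ha
  obtain ⟨β, hβ⟩ := iff_exists_map.mp hb
  exact iff_exists_map.mpr ⟨α + β, fun x => by rw [map_add, hα, hβ]⟩

theorem sub (ha : WittRegular S a) (hb : WittRegular S b) : WittRegular S fun x => a x - b x := by
  obtain ⟨α, hα⟩ := iff_exists_map.mp ha
  obtain ⟨β, hβ⟩ := iff_exists_map.mp hb
  exact iff_exists_map.mpr ⟨α - β, fun x => by rw [map_sub, hα, hβ]⟩

theorem mul (ha : WittRegular S a) (hb : WittRegular S b) : WittRegular S fun x => a x * b x := by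
  obtain ⟨α, hα⟩ := iff_exists_map.mp ha
  obtain ⟨β, hβ⟩ := iff_exists_map.mp hb
  exact iff_exists_map.mpr ⟨α * β, fun x => by rw [map_mul, hα, hβ]⟩

theorem const (c : WittVector p k) : WittRegular S fun _ => c := fun n =>
  S.algebraMap_mem (c.coeff n)

theorem teichmuller {f : X → k} (hf : f ∈ S) :
    WittRegular S fun x => WittVector.teichmuller p (f x) :=
  iff_exists_map.mpr ⟨WittVector.teichmuller p ⟨f, hf⟩, fun x => by
    rw [WittVector.map_teichmuller]
    rfl⟩

theorem sum {ι : Type*} (s : Finset ι) {a : ι → X → WittVector p k}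
    (ha : ∀ i ∈ s, WittRegular S (a i)) : WittRegular S fun x => ∑ i ∈ s, a i x := by
  classical
  induction s using Finset.induction_on with
  | empty => simpa using const 0
  | insert i s hi ih =>
    simp only [Finset.sum_insert hi]
    exact (ha i (Finset.mem_insert_self i s)).add
      (ih fun j hj => ha j (Finset.mem_insert_of_mem hj))

end WittRegular

/-- An algebra of functions that is closed under `p`-th roots. -/
def RootClosed (p : ℕ) {X : Type*} (S : Subalgebra k (X → k)) : Prop :=
  ∀ f : X → k, f ^ p ∈ S → f ∈ S

theorem RootClosed.of_pow {X : Type*} {S : Subalgebra k (X → k)} (hS : RootClosed p S)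
    {f : X → k} {m : ℕ} (hf : f ^ p ^ m ∈ S) : f ∈ S := by
  induction m with
  | zero => simpa using hf
  | succ m ih => exact ih (hS _ (by rwa [← pow_mul, ← pow_succ]))

variable (p) in
/-- The functions whose `p^m`-th power lies in `S` for some `m`. -/
def rootClosure {X : Type*} (S : Subalgebra k (X → k)) : Subalgebra k (X → k) where
  carrier := {f | ∃ m, f ^ p ^ m ∈ S}
  mul_mem' := by
    rintro f g ⟨m, hf⟩ ⟨n, hg⟩
    refine ⟨m + n, ?_⟩
    rw [mul_pow, pow_add, pow_mul f, mul_comm (p ^ m), pow_mul g]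
    exact S.mul_mem (S.pow_mem hf _) (S.pow_mem hg _)
  add_mem' := by
    rintro f g ⟨m, hf⟩ ⟨n, hg⟩
    have : f ^ p ^ (m + n) + g ^ p ^ (m + n) ∈ S := by
      rw [pow_add, pow_mul f, mul_comm (p ^ m), pow_mul g]
      exact S.add_mem (S.pow_mem hf _) (S.pow_mem hg _)
    refine ⟨m + n, ?_⟩
    convert this using 1
    ext x
    exact add_pow_char_pow ..
  algebraMap_mem' c := ⟨0, S.pow_mem (S.algebraMap_mem c) _⟩

theorem rootClosed_rootClosure {X : Type*} (S : Subalgebra k (X → k)) :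
    RootClosed p (rootClosure p S) := by
  rintro f ⟨m, hm⟩
  exact ⟨m + 1, by rwa [pow_succ', pow_mul]⟩

theorem le_rootClosure {X : Type*} (S : Subalgebra k (X → k)) : S ≤ rootClosure p S :=
  fun _ hf => ⟨0, S.pow_mem hf _⟩

variable {L : Type*} [AddCommGroup L] [Module (WittVector p k) L]

variable (p k L) in
/-- The polynomials in the `p^m`-th roots of the Witt components of the linear forms on `L`. -/
def wittFunctions : Subalgebra k (L → k) :=
  Algebra.adjoin k {g | ∃ (l : Module.Dual (WittVector p k) L) (n m : ℕ),
    ∀ x, g x ^ p ^ m = (l x).coeff n}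

theorem wittRegular_dual (l : Module.Dual (WittVector p k) L) :
    WittRegular (wittFunctions p k L) fun x => l x := fun n =>
  Algebra.subset_adjoin ⟨l, n, 0, fun x => by simp⟩

/-- The criterion for all pull-backs below: regularity of a map into `L` need only be tested on
linear forms, once the target algebra is closed under p-th roots. -/
theorem wittFunctions_comp_mem {Y : Type*} {S : Subalgebra k (Y → k)} (hS : RootClosed p S)
    {φ : Y → L} (hφ : ∀ l : Module.Dual (WittVector p k) L, WittRegular S fun y => l (φ y))
    {f : L → k} (hf : f ∈ wittFunctions p k L) : (fun y => f (φ y)) ∈ S := by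
  have : wittFunctions p k L ≤
      S.comap (AlgHom.pi fun y => Pi.evalAlgHom k (fun _ : L => k) (φ y)) := by
    refine Algebra.adjoin_le ?_
    rintro g ⟨l, n, m, hg⟩
    refine hS.of_pow (m := m) ?_
    convert hφ l n using 1
    ext y
    exact hg (φ y)
  exact this hf

theorem rootClosed_wittFunctions : RootClosed p (wittFunctions p k L) := by
  have key : ∀ f ∈ wittFunctions p k L,
      (fun x => (frobeniusEquiv k p).symm (f x)) ∈ wittFunctions p k L := by
    intro f hf
    refine Algebra.adjoin_induction (fun g hg => ?_) (fun c => ?_) (fun f g _ _ hf hg => ?_)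
      (fun f g _ _ hf hg => ?_) hf
    · obtain ⟨l, n, m, hg⟩ := hg
      refine Algebra.subset_adjoin ⟨l, n, m + 1, fun x => ?_⟩
      rw [pow_succ', pow_mul, ← hg]
      congr 1
      exact (frobeniusEquiv k p).apply_symm_apply _
    · exact Subalgebra.algebraMap_mem _ ((frobeniusEquiv k p).symm c)
    · convert Subalgebra.add_mem _ hf hg using 1
      ext x
      simp
    · convert Subalgebra.mul_mem _ hf hg using 1
      ext x
      simp
  intro f hf
  convert key _ hf using 1
  ext x
  exact ((frobeniusEquiv k p).symm_apply_apply (f x)).symm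

theorem wittFunctions_translation_mem {f : L → k} (hf : f ∈ wittFunctions p k L) (w : L) :
    translation k w f ∈ wittFunctions p k L :=
  wittFunctions_comp_mem rootClosed_wittFunctions (φ := (· + w)) (fun l => by
    simp only [map_add]
    exact (wittRegular_dual l).add (.const _)) hf

open scoped Pointwise in
/-- The functions of two variables whose specialisations at points of the second variable span a
finite-dimensional space. -/
def finiteFamilies (k X Y : Type*) [Field k] : Subalgebra k (X × Y → k) where
  carrier := {F | ∃ s : Set (X → k), s.Finite ∧ ∀ y, (fun x => F (x, y)) ∈ Submodule.span k s}
  mul_mem' := by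
    rintro F F' ⟨s, hs, hF⟩ ⟨s', hs', hF'⟩
    refine ⟨s * s', hs.mul hs', fun y => ?_⟩
    rw [← Submodule.span_mul_span]
    exact Submodule.mul_mem_mul (hF y) (hF' y)
  add_mem' := by
    rintro F F' ⟨s, hs, hF⟩ ⟨s', hs', hF'⟩
    refine ⟨s ∪ s', hs.union hs', fun y => ?_⟩
    exact Submodule.add_mem _ (Submodule.span_mono Set.subset_union_left (hF y))
      (Submodule.span_mono Set.subset_union_right (hF' y))
  algebraMap_mem' c := ⟨{1}, Set.finite_singleton _, fun y => by
    convert Submodule.smul_mem _ c (Submodule.mem_span_singleton_self (1 : X → k)) using 1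
    ext x
    simp⟩

theorem rootClosed_finiteFamilies (X Y : Type*) : RootClosed p (finiteFamilies k X Y) := by
  rintro F ⟨s, hs, hF⟩
  let r : (X → k) → (X → k) := fun g x => (frobeniusEquiv k p).symm (g x)
  refine ⟨r '' s, hs.image r, fun y => ?_⟩
  have key : ∀ g ∈ Submodule.span k s, r g ∈ Submodule.span k (r '' s) := by
    intro g hg
    induction hg using Submodule.span_induction with
    | mem g hg => exact Submodule.subset_span ⟨g, hg, rfl⟩
    | zero =>
      convert Submodule.zero_mem _ using 1
      ext x
      simp [r]
    | add g g' _ _ hg hg' =>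
      convert Submodule.add_mem _ hg hg' using 1
      ext x
      simp [r]
    | smul c g _ hg =>
      convert Submodule.smul_mem _ ((frobeniusEquiv k p).symm c) hg using 1
      ext x
      simp [r]
  convert key _ (hF y) using 1
  ext x
  exact ((frobeniusEquiv k p).symm_apply_apply _).symm

/-- Local finiteness of the translation action: pull back along addition L × L → L into
`finiteFamilies`. -/
theorem wittFunctions_translation_finite {f : L → k} (hf : f ∈ wittFunctions p k L) :
    ∃ V : Submodule k (L → k), FiniteDimensional k V ∧ ∀ w, translation k w f ∈ V := by
  have h := wittFunctions_comp_mem (rootClosed_finiteFamilies L L) (φ := fun z : L × L => z.1 + z.2)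
    (fun l => by
      simp only [map_add]
      refine WittRegular.add (fun n => ?_) (fun n => ?_)
      · exact ⟨{fun x => (l x).coeff n}, Set.finite_singleton _,
          fun y => Submodule.mem_span_singleton_self _⟩
      · refine ⟨{1}, Set.finite_singleton _, fun y => ?_⟩
        convert Submodule.smul_mem _ ((l y).coeff n)
          (Submodule.mem_span_singleton_self (1 : L → k)) using 1
        ext x
        simp) hf
  obtain ⟨s, hs, hF⟩ := h
  exact ⟨Submodule.span k s, FiniteDimensional.span_of_finite k hs, hF⟩

variable (p) in
/-- The functions of `(x, t)` a `p`-power of which is a polynomial in `t` with coefficients in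
`A`. -/
def polynomialFamilies {X : Type*} (A : Subalgebra k (X → k)) : Subalgebra k (X × k → k) :=
  rootClosure p
    { carrier := {F | ∃ Q : A[X], ∀ x t, F (x, t) = Q.eval₂ (evalAt A x) t}
      mul_mem' := by
        rintro F F' ⟨Q, hQ⟩ ⟨Q', hQ'⟩
        exact ⟨Q * Q', fun x t => by simp [hQ, hQ', Polynomial.eval₂_mul]⟩
      add_mem' := by
        rintro F F' ⟨Q, hQ⟩ ⟨Q', hQ'⟩
        exact ⟨Q + Q', fun x t => by simp [hQ, hQ']⟩
      algebraMap_mem' := fun c => ⟨Polynomial.C (algebraMap k A c), fun x t => by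
        rw [Polynomial.eval₂_C]
        rfl⟩ }

theorem mem_polynomialFamilies {X : Type*} {A : Subalgebra k (X → k)} {F : X × k → k} :
    F ∈ polynomialFamilies p A ↔
      ∃ m, ∃ Q : A[X], ∀ x t, F (x, t) ^ p ^ m = Q.eval₂ (evalAt A x) t :=
  Iff.rfl

theorem fst_mem_polynomialFamilies {X : Type*} {A : Subalgebra k (X → k)} {f : X → k}
    (hf : f ∈ A) : (fun z : X × k => f z.1) ∈ polynomialFamilies p A :=
  mem_polynomialFamilies.mpr ⟨0, Polynomial.C ⟨f, hf⟩, fun x t => by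
    rw [Polynomial.eval₂_C, pow_zero, pow_one]
    rfl⟩

theorem snd_mem_polynomialFamilies {X : Type*} {A : Subalgebra k (X → k)} :
    (fun z : X × k => z.2) ∈ polynomialFamilies p A :=
  mem_polynomialFamilies.mpr ⟨0, Polynomial.X, fun x t => by simp⟩

theorem wittFunctions_family_mem {f : L → k} (hf : f ∈ wittFunctions p k L) {θ : k → L}
    (hθ : ∀ l : Module.Dual (WittVector p k) L,
      WittRegular (polynomialFamilies p (wittFunctions p k L)) fun z : L × k => l (θ z.2)) :
    (fun z : L × k => f (z.1 + θ z.2)) ∈ polynomialFamilies p (wittFunctions p k L) :=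
  wittFunctions_comp_mem (rootClosed_rootClosure _) (φ := fun z : L × k => z.1 + θ z.2)
    (fun l => by
      simp only [map_add]
      exact WittRegular.add (fun n => fst_mem_polynomialFamilies (wittRegular_dual l n)) (hθ l)) hf

/-- The regular functions on `L` that are invariant under translation by `H`. -/
def invariantFunctions (p : ℕ) [Fact p.Prime] (k : Type*) [Field k] [CharP k p] {L : Type*}
    [AddCommGroup L] [Module (WittVector p k) L] (H : AddSubgroup L) : Subalgebra k (L → k) where
  carrier := {f | f ∈ wittFunctions p k L ∧ ∀ h ∈ H, ∀ x, f (x + h) = f x}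
  mul_mem' hf hg := ⟨Subalgebra.mul_mem _ hf.1 hg.1, fun h hh x => by
    simp [hf.2 h hh x, hg.2 h hh x]⟩
  add_mem' hf hg := ⟨Subalgebra.add_mem _ hf.1 hg.1, fun h hh x => by
    simp [hf.2 h hh x, hg.2 h hh x]⟩
  algebraMap_mem' c := ⟨Subalgebra.algebraMap_mem _ c, fun h hh x => by simp⟩

theorem invariantFunctions_eq_of_sub_mem {H : AddSubgroup L} {f : L → k}
    (hf : f ∈ invariantFunctions p k H) {x y : L} (hxy : x - y ∈ H) : f x = f y := by
  rw [← hf.2 _ hxy y, add_sub_cancel]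

/-- Over an infinite field the coefficients of a polynomial are determined by its values, so they
inherit the invariance of the family. -/
theorem mem_polynomialFamilies_invariantFunctions {H : AddSubgroup L} {F : L × k → k}
    (hF : F ∈ polynomialFamilies p (wittFunctions p k L))
    (hinv : ∀ h ∈ H, ∀ x t, F (x + h, t) = F (x, t)) :
    F ∈ polynomialFamilies p (invariantFunctions p k H) := by
  obtain ⟨m, Q, hQ⟩ := hF
  have hmem : ∀ i, (Q.coeff i : L → k) ∈ invariantFunctions p k H := by
    intro i
    refine ⟨(Q.coeff i).2, fun h hh x => ?_⟩
    have : Q.map (evalAt _ (x + h)) = Q.map (evalAt _ x) := Polynomial.funext fun t => by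
      have h1 := hQ (x + h) t
      have h2 := hQ x t
      simp only [Pi.pow_apply] at h1 h2
      rw [Polynomial.eval_map, Polynomial.eval_map, ← h1, ← h2, hinv h hh]
    simpa [Polynomial.coeff_map] using congrArg (fun q => q.coeff i) this
  refine mem_polynomialFamilies.mpr
    ⟨m, ∑ i ∈ Q.support, Polynomial.C ⟨_, hmem i⟩ * X ^ i, fun x t => ?_⟩
  refine (hQ x t).trans ?_
  rw [Polynomial.eval₂_eq_sum, Polynomial.sum_def, Polynomial.eval₂_finsetSum]
  simp only [Polynomial.eval₂_mul, Polynomial.eval₂_C, Polynomial.eval₂_X_pow]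
  rfl

/-- Additivity of θ is needed only modulo `H`, which is all that Teichmüller representatives
provide. -/
theorem isOneParameter_invariantFunctions {H : AddSubgroup L} {n : ℕ}
    (hn : ∀ x : L, p ^ n • x ∈ H) {θ : k → L} (hadd : ∀ s t, θ (s + t) - (θ s + θ t) ∈ H)
    (hθ : ∀ l : Module.Dual (WittVector p k) L,
      WittRegular (polynomialFamilies p (wittFunctions p k L)) fun z : L × k => l (θ z.2)) :
    IsOneParameter p (invariantFunctions p k H) θ where
  translate f hf w := ⟨wittFunctions_translation_mem hf.1 w, fun h hh x => by
    rw [translation_apply, translation_apply, add_right_comm, hf.2 h hh]⟩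
  root f hf := ⟨rootClosed_wittFunctions f hf.1, fun h hh x =>
    frobenius_inj k p (hf.2 h hh x)⟩
  family f hf := mem_polynomialFamilies.mp <|
    mem_polynomialFamilies_invariantFunctions (wittFunctions_family_mem hf.1 hθ)
      fun h hh x t => by
        simp only [add_right_comm x h]
        exact hf.2 h hh _
  map_add f hf x s t := invariantFunctions_eq_of_sub_mem hf (by
    convert hadd s t using 1
    abel)
  finite f hf := wittFunctions_translation_finite hf.1
  torsion := ⟨n, fun f hf w x => hf.2 _ (hn w) x⟩

end WittFunctions

/-! ### Functions on the truncations L / p^n L -/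

section Truncation

variable {p : ℕ} [Fact p.Prime] {k : Type*} [Field k] [IsAlgClosed k] [CharP k p]
  {L : Type*} [AddCommGroup L] [Module (WittVector p k) L]

variable (p L) in
/-- The subgroup `p^n L` of `L`. -/
def powSubgroup (n : ℕ) : AddSubgroup L := (nsmulAddMonoidHom (α := L) (p ^ n)).range

theorem mem_powSubgroup {n : ℕ} {x : L} : x ∈ powSubgroup p L n ↔ ∃ y, p ^ n • y = x := Iff.rfl

theorem pow_smul_eq_nsmul (n : ℕ) (x : L) : (p : WittVector p k) ^ n • x = p ^ n • x := by
  rw [← Nat.cast_pow, Nat.cast_smul_eq_nsmul]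

theorem coeff_eq_of_sub_eq {n : ℕ} {a b c : WittVector p k} (h : a - b = p ^ n * c) {j : ℕ}
    (hj : j < n) : a.coeff j = b.coeff j := by
  refine (WittVector.le_coeff_eq_iff_le_sub_coeff_eq_zero (n := n)).mpr (fun i hi => ?_) j hj
  rw [h, mul_comm]
  exact WittVector.mul_pow_charP_coeff_zero _ hi

theorem exists_sub_eq_of_coeff_eq {n : ℕ} {a b : WittVector p k}
    (h : ∀ j < n, a.coeff j = b.coeff j) : ∃ c, a - b = p ^ n * c := by
  have h1 := (WittVector.mem_span_p_pow_iff_le_coeff_eq_zero (p := p) (a - b) n).mpr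
    (WittVector.le_coeff_eq_iff_le_sub_coeff_eq_zero.mp h)
  exact Ideal.mem_span_singleton.mp h1

/-- Modulo p^n every point equals its truncation, whose coordinates involve only the first n Witt
components. An invariant function is thus, up to a p-power, a polynomial in finitely many
coordinates. -/
theorem almostFinite_invariantFunctions_powSubgroup [Module.Free (WittVector p k) L]
    [Module.Finite (WittVector p k) L] (n : ℕ) :
    AlmostFinite (invariantFunctions p k (powSubgroup p L n)) := by
  classical
  let ι := Module.Free.ChooseBasisIndex (WittVector p k) L
  let b : Module.Basis ι (WittVector p k) L := Module.Free.chooseBasis (WittVector p k) L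
  let g : ι × Fin n → L → k := fun z x => (b.repr x z.1).coeff z.2
  let S : Subalgebra k (L → k) := Algebra.adjoin k (Set.range g)
  refine ⟨S, ?_, Subalgebra.fg_def.mpr ⟨_, Set.finite_range g, rfl⟩, fun f hf => ?_⟩
  · refine Algebra.adjoin_le ?_
    rintro _ ⟨⟨i, j⟩, rfl⟩
    refine ⟨wittRegular_dual (b.coord i) j, ?_⟩
    rintro _ ⟨y, rfl⟩ x
    refine coeff_eq_of_sub_eq (c := b.repr y i) (n := n) ?_ j.2
    simp
  · let t : WittVector p k → WittVector p k := fun a =>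
      WittVector.mk p fun j => if j < n then a.coeff j else 0
    let τ : L → L := fun x => ∑ i, t (b.repr x i) • b i
    have hτ : ∀ x, f x = f (τ x) := by
      intro x
      have h1 : ∀ i, ∃ c, b.repr x i - t (b.repr x i) = p ^ n * c := fun i =>
        exists_sub_eq_of_coeff_eq fun j hj => by
          change _ = if j < n then _ else _
          rw [if_pos hj]
      choose c hc using h1
      refine invariantFunctions_eq_of_sub_mem hf ⟨∑ i, c i • b i, ?_⟩
      have h2 : x - τ x = ∑ i, (p : WittVector p k) ^ n • c i • b i := by
        simp only [← mul_smul, ← hc, sub_smul, Finset.sum_sub_distrib, b.sum_repr, τ]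
      rw [h2, ← Finset.smul_sum]
      exact (pow_smul_eq_nsmul n _).symm
    have hmem : f ∈ rootClosure p S := by
      rw [show f = fun x => f (τ x) from funext hτ]
      refine wittFunctions_comp_mem (rootClosed_rootClosure S) (fun l => ?_) hf.1
      simp only [τ, map_sum, map_smul, smul_eq_mul]
      refine WittRegular.sum _ fun i _ => WittRegular.mul (fun j => ?_) (.const _)
      refine le_rootClosure S ?_
      by_cases hj : j < n
      · refine Algebra.subset_adjoin ⟨⟨i, ⟨j, hj⟩⟩, ?_⟩
        ext x
        exact (if_pos hj).symm
      · convert S.zero_mem using 1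
        ext x
        exact if_neg hj
    obtain ⟨m, hm⟩ := hmem
    exact IsIntegral.of_pow (pow_pos (Fact.out : p.Prime).pos m)
      (isIntegral_algebraMap (R := S) (x := ⟨_, hm⟩))

end Truncation

/-! ### Solving linear Frobenius equations over the Witt vectors -/

section FrobeniusEquation

variable {p : ℕ} [Fact p.Prime] {k : Type*} [Field k] [IsAlgClosed k] [CharP k p]

/-- The operator `∑ aᵢ σⁱ` on the Witt vectors. -/
noncomputable def frobeniusOperator (N : ℕ) (a : ℕ → WittVector p k) : WittVector p k →+ WittVector p k :=
  AddMonoidHom.mk' (fun z => ∑ i ∈ Finset.range (N + 1), a i * WittVector.frobenius^[i] z)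
    fun x y => by
      simp only [← RingHom.coe_pow, map_add, mul_add, Finset.sum_add_distrib]

theorem frobeniusOperator_apply (N : ℕ) (a : ℕ → WittVector p k) (z : WittVector p k) :
    frobeniusOperator N a z =
      ∑ i ∈ Finset.range (N + 1), a i * WittVector.frobenius^[i] z := rfl

theorem frobeniusOperator_pow_mul (N : ℕ) (a : ℕ → WittVector p k) (n : ℕ) (z : WittVector p k) :
    frobeniusOperator N a (p ^ n * z) = p ^ n * frobeniusOperator N a z := by
  rw [← Nat.cast_pow, ← nsmul_eq_mul, map_nsmul, nsmul_eq_mul]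

/-- Modulo p and on Teichmüller elements the equation becomes ∑ aᵢ T^(p^i) = c over the
algebraically closed field. -/
theorem exists_frobeniusOperator_eq_mod {N : ℕ} {a : ℕ → WittVector p k}
    (ha : ∃ i ≤ N, (a i).coeff 0 ≠ 0) (c : WittVector p k) :
    ∃ z c', c = frobeniusOperator N a z + p * c' := by
  obtain ⟨i₀, hi₀, hai₀⟩ := ha
  let P : k[X] := ∑ i ∈ Finset.range (N + 1), Polynomial.C ((a i).coeff 0) * X ^ p ^ i
  have hp := (Fact.out : p.Prime).one_lt
  have hcoeff : P.coeff (p ^ i₀) = (a i₀).coeff 0 := by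
    simp only [P, Polynomial.finsetSum_coeff, Polynomial.coeff_C_mul_X_pow]
    rw [Finset.sum_eq_single i₀]
    · simp
    · intro i _ hi
      rw [if_neg]
      exact fun h => hi (Nat.pow_right_injective hp h).symm
    · intro h
      exact absurd (Finset.mem_range.mpr (Nat.lt_succ_of_le hi₀)) h
  -- The nonzero coefficient sits in degree p^i₀ ≥ 1, also when i₀ = 0, so subtracting a constant
  -- does not affect it.
  have hdeg : (P - Polynomial.C (c.coeff 0)).degree ≠ 0 := by
    intro h0
    have h1 : (P - Polynomial.C (c.coeff 0)).coeff (p ^ i₀) = 0 := by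
      refine Polynomial.coeff_eq_zero_of_degree_lt ?_
      rw [h0]
      exact_mod_cast pow_pos (Fact.out : p.Prime).pos i₀
    rw [Polynomial.coeff_sub, hcoeff, Polynomial.coeff_C_of_ne_zero (pow_pos
      (Fact.out : p.Prime).pos i₀).ne', sub_zero] at h1
    exact hai₀ h1
  obtain ⟨t, ht⟩ := IsAlgClosed.exists_root _ hdeg
  have hfrob : ∀ i, (WittVector.frobenius^[i] (WittVector.teichmuller p t)).coeff 0 =
      t ^ p ^ i := fun i => by
    rw [WittVector.iterate_frobenius_coeff, WittVector.teichmuller_coeff_zero]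
  have h0 : (c - frobeniusOperator N a (WittVector.teichmuller p t)).coeff 0 = 0 := by
    rw [← WittVector.constantCoeff_apply, map_sub, frobeniusOperator_apply, map_sum]
    simp only [map_mul, WittVector.constantCoeff_apply, hfrob]
    have h2 : P.eval t = c.coeff 0 := by
      rw [Polynomial.IsRoot.def, Polynomial.eval_sub, Polynomial.eval_C] at ht
      exact sub_eq_zero.mp ht
    rw [← h2]
    simp [P, Polynomial.eval_finsetSum]
  obtain ⟨c', hc'⟩ := Ideal.mem_span_singleton.mp
    ((WittVector.mem_span_p_iff_coeff_zero_eq_zero _).mpr h0)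
  exact ⟨_, c', by rw [← hc']; ring⟩

/-- Successive approximation: the operator commutes with multiplication by p, so solutions modulo p
assemble into a p-adically convergent series. -/
theorem frobeniusOperator_surjective {N : ℕ} {a : ℕ → WittVector p k}
    (ha : ∃ i ≤ N, (a i).coeff 0 ≠ 0) : Function.Surjective (frobeniusOperator N a) := by
  intro c
  choose z r hzr using exists_frobeniusOperator_eq_mod ha
  let e : ℕ → WittVector p k := fun n => r^[n] c
  let s : ℕ → WittVector p k := fun n => ∑ j ∈ Finset.range n, p ^ j * z (e j)
  have hs : ∀ n, c = frobeniusOperator N a (s n) + p ^ n * e n := by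
    intro n
    induction n with
    | zero => simp [s, e]
    | succ n ih =>
      have h1 : e (n + 1) = r (e n) := Function.iterate_succ_apply' r n c
      have h2 : s (n + 1) = s n + p ^ n * z (e n) := Finset.sum_range_succ _ _
      rw [h1, h2, map_add, frobeniusOperator_pow_mul]
      conv_lhs => rw [ih, hzr (e n)]
      ring
  have hI : ∀ n, (Ideal.span {(p : WittVector p k)} ^ n • ⊤ :
      Submodule (WittVector p k) (WittVector p k)) = Ideal.span {(p : WittVector p k) ^ n} := by
    intro n
    rw [Ideal.span_singleton_pow, smul_eq_mul, Ideal.mul_top]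
  obtain ⟨y, hy⟩ := IsPrecomplete.prec (I := Ideal.span {(p : WittVector p k)})
    (inferInstance : IsPrecomplete (Ideal.span {(p : WittVector p k)}) (WittVector p k))
    (f := s) (fun {m n} hmn => by
      rw [SModEq.sub_mem, hI, Ideal.mem_span_singleton, dvd_sub_comm]
      simp only [s]
      rw [← Finset.sum_range_add_sum_Ico _ hmn, add_sub_cancel_left]
      exact Finset.dvd_sum fun j hj =>
        (pow_dvd_pow _ (Finset.mem_Ico.mp hj).1).mul_right _)
  refine ⟨y, sub_eq_zero.mp (IsHausdorff.haus (I := Ideal.span {(p : WittVector p k)})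
    inferInstance _ fun n => ?_)⟩
  rw [SModEq.sub_mem, sub_zero, hI, Ideal.mem_span_singleton]
  have h1 := hy n
  rw [SModEq.sub_mem, hI, Ideal.mem_span_singleton] at h1
  obtain ⟨d, hd⟩ := h1
  have h2 : frobeniusOperator N a y = frobeniusOperator N a (s n) - p ^ n *
      frobeniusOperator N a d := by
    rw [← frobeniusOperator_pow_mul, ← map_sub, ← hd, sub_sub_cancel]
  refine ⟨-frobeniusOperator N a d - e n, ?_⟩
  rw [h2]
  conv_lhs => rw [hs n]
  ring

/-- Dividing all coefficients by their largest common power of p leaves one that is a unit. -/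
theorem exists_frobeniusOperator_eq_pow_mul {N : ℕ} {a : ℕ → WittVector p k}
    (ha : ∃ i ≤ N, a i ≠ 0) : ∃ m : ℕ, ∀ c, ∃ z, frobeniusOperator N a z = p ^ m * c := by
  classical
  have hne : ∃ m : ℕ, ∃ i ≤ N, ∃ b : WittVector p k, b.coeff 0 ≠ 0 ∧ a i = p ^ m * b := by
    obtain ⟨i, hi, hai⟩ := ha
    obtain ⟨m, b, hb, hab⟩ := WittVector.exists_eq_pow_p_mul (a i) hai
    exact ⟨m, i, hi, b, hb, hab⟩
  have hdvd : ∀ i, ∃ b : WittVector p k, i ≤ N → a i = p ^ Nat.find hne * b := by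
    intro i
    by_cases hi : i ≤ N
    · by_cases h0 : a i = 0
      · exact ⟨0, fun _ => by rw [h0, mul_zero]⟩
      · obtain ⟨m, b, hb, hab⟩ := WittVector.exists_eq_pow_p_mul (a i) h0
        obtain ⟨d, hd⟩ := Nat.exists_eq_add_of_le (Nat.find_min' hne ⟨i, hi, b, hb, hab⟩)
        exact ⟨p ^ d * b, fun _ => by rw [hab, hd, pow_add, mul_assoc]⟩
    · exact ⟨0, fun h => absurd h hi⟩
  choose b hb using hdvd
  have hunit : ∃ i ≤ N, (b i).coeff 0 ≠ 0 := by
    obtain ⟨i, hi, b', hb', hab⟩ := Nat.find_spec hne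
    refine ⟨i, hi, ?_⟩
    have h1 := (hb i hi).symm.trans hab
    rwa [mul_left_cancel₀ (pow_ne_zero _ (WittVector.p_nonzero p k)) h1]
  refine ⟨Nat.find hne, fun c => ?_⟩
  obtain ⟨z, hz⟩ := frobeniusOperator_surjective hunit c
  refine ⟨z, ?_⟩
  rw [← hz, frobeniusOperator_apply, frobeniusOperator_apply, Finset.mul_sum]
  refine Finset.sum_congr rfl fun i hi => ?_
  rw [hb i (Nat.lt_succ_iff.mp (Finset.mem_range.mp hi)), mul_assoc]

end FrobeniusEquation

/-! ### The image of F - p is open -/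

section FrobeniusSubP

variable {p : ℕ} [Fact p.Prime] {k : Type*} [Field k] [IsAlgClosed k] [CharP k p]
  {L : Type*} [AddCommGroup L] [Module (WittVector p k) L]

/-- The map `F - p`. -/
noncomputable def frobeniusSubP (F : L →ₛₗ[sigma p k] L) : L →+ L :=
  F.toAddMonoidHom - nsmulAddMonoidHom (α := L) p

theorem p_smul_eq_nsmul (x : L) : (p : WittVector p k) • x = p • x :=
  Nat.cast_smul_eq_nsmul _ _ _

/-- Modulo the image of F - p, the operator F acts as multiplication by p. -/
theorem iterate_smul_sub_mem_range (F : L →ₛₗ[sigma p k] L) (a : WittVector p k) (y : L)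
    (i : ℕ) :
    WittVector.frobenius^[i] a • F^[i] y - (p : WittVector p k) ^ i • a • y ∈
      (frobeniusSubP F).range := by
  induction i with
  | zero => simp
  | succ i ih =>
    have h1 : F (WittVector.frobenius^[i] a • F^[i] y) -
        p • (WittVector.frobenius^[i] a • F^[i] y) ∈ (frobeniusSubP F).range := ⟨_, rfl⟩
    have h2 := AddSubgroup.nsmul_mem _ ih p
    convert AddSubgroup.add_mem _ h1 h2 using 1
    rw [LinearMap.map_smulₛₗ, Function.iterate_succ_apply', Function.iterate_succ_apply',
      pow_succ', mul_smul, p_smul_eq_nsmul, smul_sub]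
    abel

theorem iterate_frobenius_symm (i N : ℕ) (hi : i ≤ N) (a z : WittVector p k) :
    WittVector.frobenius^[i] ((WittVector.frobeniusEquiv p k).symm^[i] a *
      WittVector.frobenius^[N - i] z) = a * WittVector.frobenius^[N] z := by
  have h1 : Function.LeftInverse (WittVector.frobenius : WittVector p k → WittVector p k)
      (WittVector.frobeniusEquiv p k).symm := (WittVector.frobeniusEquiv p k).apply_symm_apply
  rw [← RingHom.coe_pow, map_mul, RingHom.coe_pow, h1.iterate i a, ← Function.iterate_add_apply,
    Nat.add_sub_cancel' hi]

/-- A nontrivial relation ∑ bᵢ Fⁱy = 0 exists by rank. Multiplied by σ^N(z) and read modulo the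
image of F - p, it becomes ∑ pⁱ σ⁻ⁱ(bᵢ) σ^(N-i)(z) y ≡ 0. The coefficient of y is a nonzero
Frobenius operator in z, hence takes every value in p^m W for some m. -/
theorem exists_pow_smul_mem_range [Module.Free (WittVector p k) L]
    [Module.Finite (WittVector p k) L] (F : L →ₛₗ[sigma p k] L) (y : L) :
    ∃ m : ℕ, ∀ c : WittVector p k, (p : WittVector p k) ^ m • c • y ∈
      (frobeniusSubP F).range := by
  classical
  let N := Module.finrank (WittVector p k) L
  have hdep : ¬ LinearIndependent (WittVector p k) fun i : Fin (N + 1) => F^[i] y := by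
    intro h
    have := h.fintype_card_le_finrank
    simp [N] at this
  obtain ⟨g, hg, i₀, hi₀⟩ := Fintype.not_linearIndependent_iff.mp hdep
  let b : ℕ → WittVector p k := fun i => if h : i < N + 1 then g ⟨i, h⟩ else 0
  have hbi : ∀ i : Fin (N + 1), b i = g i := fun i => dif_pos i.2
  have hb : ∑ i ∈ Finset.range (N + 1), b i • F^[i] y = 0 := by
    rw [← hg, Finset.sum_range]
    exact Finset.sum_congr rfl fun i _ => by rw [hbi]
  let s : WittVector p k → WittVector p k := (WittVector.frobeniusEquiv p k).symm
  have hs0 : ∀ i a, s^[i] a = 0 → a = 0 := by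
    intro i a h
    have h1 := iterate_frobenius_symm i i le_rfl a 1
    rw [h, zero_mul] at h1
    simpa [← RingHom.coe_pow] using h1.symm
  -- The substitution j = N - i orders the operator by powers of σ applied to z; the power σ^N is
  -- included to avoid negative exponents.
  let a : ℕ → WittVector p k := fun j => p ^ (N - j) * s^[N - j] (b (N - j))
  have ha : ∃ i ≤ N, a i ≠ 0 := by
    refine ⟨N - i₀, Nat.sub_le _ _, mul_ne_zero (pow_ne_zero _ (WittVector.p_nonzero p k)) ?_⟩
    rw [Nat.sub_sub_self (Nat.lt_succ_iff.mp i₀.2)]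
    intro h
    refine hi₀ ?_
    have := hs0 _ _ h
    rwa [hbi] at this
  obtain ⟨m, hm⟩ := exists_frobeniusOperator_eq_pow_mul ha
  refine ⟨m, fun c => ?_⟩
  obtain ⟨z, hz⟩ := hm c
  rw [← mul_smul, ← hz, frobeniusOperator_apply, Finset.sum_smul]
  have h1 : ∑ i ∈ Finset.range (N + 1), (a i * WittVector.frobenius^[i] z) • y =
      ∑ i ∈ Finset.range (N + 1),
        (p : WittVector p k) ^ i • (s^[i] (b i) * WittVector.frobenius^[N - i] z) • y := by
    rw [← Finset.sum_range_reflect]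
    refine Finset.sum_congr rfl fun i hi => ?_
    have hi' : i ≤ N := Nat.lt_succ_iff.mp (Finset.mem_range.mp hi)
    rw [← mul_smul]
    simp only [a, Nat.add_sub_cancel]
    rw [Nat.sub_sub_self hi', mul_assoc]
  have h2 : ∑ i ∈ Finset.range (N + 1), WittVector.frobenius^[i]
      (s^[i] (b i) * WittVector.frobenius^[N - i] z) • F^[i] y = 0 := by
    rw [← smul_zero (WittVector.frobenius^[N] z), ← hb, Finset.smul_sum]
    refine Finset.sum_congr rfl fun i hi => ?_
    rw [iterate_frobenius_symm i N (Nat.lt_succ_iff.mp (Finset.mem_range.mp hi)), mul_comm,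
      mul_smul]
  rw [h1, ← neg_mem_iff, ← zero_sub, ← h2, ← Finset.sum_sub_distrib]
  exact AddSubgroup.sum_mem _ fun i _ => iterate_smul_sub_mem_range F _ y i

theorem exists_powSubgroup_le_range [Module.Free (WittVector p k) L]
    [Module.Finite (WittVector p k) L] (F : L →ₛₗ[sigma p k] L) :
    ∃ n, powSubgroup p L n ≤ (frobeniusSubP F).range := by
  let b := Module.Free.chooseBasis (WittVector p k) L
  choose m hm using fun i => exists_pow_smul_mem_range F (b i)
  refine ⟨∑ i, m i, ?_⟩
  rintro _ ⟨y, rfl⟩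
  change p ^ (∑ i, m i) • y ∈ _
  rw [← pow_smul_eq_nsmul (k := k), ← b.sum_repr y, Finset.smul_sum]
  refine AddSubgroup.sum_mem _ fun i _ => ?_
  obtain ⟨d, hd⟩ := Nat.exists_eq_add_of_le (Finset.single_le_sum (f := m)
    (fun _ _ => Nat.zero_le _) (Finset.mem_univ i))
  rw [hd, pow_add, mul_smul, ← mul_smul (_ ^ d)]
  exact hm i _

end FrobeniusSubP

/-! ### Lengths of quotients of lattices -/

section Chains

variable {p : ℕ} [Fact p.Prime] {k : Type*} [Field k] [IsAlgClosed k] [CharP k p]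
  {L L' : Type*} [AddCommGroup L] [Module (WittVector p k) L]
  [AddCommGroup L'] [Module (WittVector p k) L']

/-- `LatticeChain Q Q' n` says that `Q ≤ Q'` and that `Q' / Q` has length `n`: there is a chain of
submodules from `Q` to `Q'` with `n` simple subquotients. -/
inductive LatticeChain : Submodule (WittVector p k) L → Submodule (WittVector p k) L → ℕ → Prop
  | refl (Q : Submodule (WittVector p k) L) : LatticeChain Q Q 0
  | step {Q Q' : Submodule (WittVector p k) L} {n : ℕ} (e : L) (h : LatticeChain Q Q' n)
      (he : e ∉ Q') (hpe : (p : WittVector p k) • e ∈ Q') :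
      LatticeChain Q (Q' ⊔ Submodule.span _ {e}) (n + 1)

theorem exists_eq_teichmuller_add (w : WittVector p k) :
    ∃ w', w = WittVector.teichmuller p (w.coeff 0) + p * w' := by
  have h : (w - WittVector.teichmuller p (w.coeff 0)).coeff 0 = 0 := by
    rw [← WittVector.constantCoeff_apply, map_sub]
    simp [WittVector.constantCoeff_apply]
  obtain ⟨w', hw'⟩ := Ideal.mem_span_singleton.mp
    ((WittVector.mem_span_p_iff_coeff_zero_eq_zero _).mpr h)
  exact ⟨w', by rw [← hw']; ring⟩

theorem mem_of_smul_mem_of_coeff_zero_ne_zero {Q : Submodule (WittVector p k) L} {e : L}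
    {w : WittVector p k} (hw : w.coeff 0 ≠ 0) (h : w • e ∈ Q) : e ∈ Q :=
  (Q.smul_mem_iff_of_isUnit (WittVector.isUnit_of_coeff_zero_ne_zero w hw)).mp h

theorem p_smul_mem {Q : Submodule (WittVector p k) L} {e : L}
    (hpe : (p : WittVector p k) • e ∈ Q) (w : WittVector p k) : (p * w) • e ∈ Q := by
  rw [mul_comm, mul_smul]
  exact Q.smul_mem _ hpe

/-- A Witt vector with nonzero constant component is a unit, so the quotient is a line over the
residue field. -/
theorem covBy_sup_span {Q : Submodule (WittVector p k) L} {e : L} (he : e ∉ Q)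
    (hpe : (p : WittVector p k) • e ∈ Q) : Q ⋖ Q ⊔ Submodule.span _ {e} := by
  refine ⟨lt_of_le_not_ge le_sup_left fun h => he (h (Submodule.mem_sup_right
    (Submodule.mem_span_singleton_self e))), fun X hQX hX => ?_⟩
  obtain ⟨x, hxX, hxQ⟩ := SetLike.exists_of_lt hQX
  obtain ⟨q, hq, y, hy, rfl⟩ := Submodule.mem_sup.mp (hX.le hxX)
  obtain ⟨w, rfl⟩ := Submodule.mem_span_singleton.mp hy
  have hw : w.coeff 0 ≠ 0 := by
    intro h0
    obtain ⟨w', hw'⟩ := exists_eq_teichmuller_add w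
    rw [h0, WittVector.teichmuller_zero, zero_add] at hw'
    exact hxQ (Q.add_mem hq (hw' ▸ p_smul_mem hpe w'))
  have hwe : w • e ∈ X := by
    simpa using X.sub_mem hxX (hQX.le hq)
  refine hX.not_ge (sup_le hQX.le ?_)
  rw [Submodule.span_singleton_le_iff_mem]
  exact mem_of_smul_mem_of_coeff_zero_ne_zero hw hwe

namespace LatticeChain

variable {Q Q' Q'' : Submodule (WittVector p k) L} {m n : ℕ}

theorem le (h : LatticeChain Q Q' n) : Q ≤ Q' := by
  induction h with
  | refl => exact le_rfl
  | step e _ _ _ ih => exact ih.trans le_sup_left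

theorem trans (h : LatticeChain Q Q' m) (h' : LatticeChain Q' Q'' n) :
    LatticeChain Q Q'' (m + n) := by
  induction h' with
  | refl => exact h
  | step e _ he hpe ih => exact .step e ih he hpe

theorem map {τ : WittVector p k →+* WittVector p k} [RingHomSurjective τ]
    (f : L →ₛₗ[τ] L') (hf : Function.Injective f) (h : LatticeChain Q Q' n) :
    LatticeChain (Q.map f) (Q'.map f) n := by
  induction h with
  | refl => exact .refl _
  | step e _ he hpe ih =>
    rw [Submodule.map_sup, Submodule.map_span, Set.image_singleton]
    refine .step (f e) ih (fun h => he ?_) ?_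
    · obtain ⟨x, hx, hxe⟩ := h
      rwa [← hf hxe]
    · refine ⟨_, hpe, ?_⟩
      rw [LinearMap.map_smulₛₗ, map_natCast]

theorem exists_compositionSeries (h : LatticeChain Q Q' n) :
    ∃ s : CompositionSeries (Submodule (WittVector p k) L),
      s.head = Q ∧ s.last = Q' ∧ s.length = n := by
  induction h with
  | refl => exact ⟨RelSeries.singleton _ _, rfl, rfl, rfl⟩
  | step e _ he hpe ih =>
    obtain ⟨s, hs, hs', hn⟩ := ih
    refine ⟨s.snoc _ (hs' ▸ covBy_sup_span he hpe), ?_, ?_, ?_⟩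
    · rw [RelSeries.head_snoc, hs]
    · rw [RelSeries.last_snoc, hs']
    · rw [RelSeries.snoc_length, hn]

/-- Jordan–Hölder in the modular lattice of submodules; this lets lengths be compared along two
different routes. -/
theorem length_unique (h : LatticeChain Q Q' m) (h' : LatticeChain Q Q' n) : m = n := by
  obtain ⟨s, hs, hs', rfl⟩ := h.exists_compositionSeries
  obtain ⟨t, ht, ht', rfl⟩ := h'.exists_compositionSeries
  exact (CompositionSeries.jordan_holder s t (hs.trans ht.symm) (hs'.trans ht'.symm)).length_eq

/-- Adjoin multiples of `e` by decreasing powers of p, omitting those already present. -/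
theorem exists_sup_span {e : L} {N : ℕ} (he : (p : WittVector p k) ^ N • e ∈ Q) :
    ∃ n, LatticeChain Q (Q ⊔ Submodule.span _ {e}) n := by
  induction N generalizing e with
  | zero =>
    rw [pow_zero, one_smul] at he
    refine ⟨0, ?_⟩
    rw [sup_eq_left.mpr ((Submodule.span_singleton_le_iff_mem _ _).mpr he)]
    exact .refl Q
  | succ N ih =>
    rw [pow_succ, mul_smul] at he
    obtain ⟨n, hn⟩ := ih he
    have hsup : Q ⊔ Submodule.span _ {(p : WittVector p k) • e} ⊔ Submodule.span _ {e} =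
        Q ⊔ Submodule.span _ {e} := by
      have hle : Submodule.span (WittVector p k) {(p : WittVector p k) • e} ≤
          Submodule.span _ {e} := by
        rw [Submodule.span_singleton_le_iff_mem]
        exact Submodule.smul_mem _ _ (Submodule.mem_span_singleton_self e)
      rw [sup_assoc, sup_eq_right.mpr hle]
    by_cases h : e ∈ Q ⊔ Submodule.span _ {(p : WittVector p k) • e}
    · refine ⟨n, ?_⟩
      rwa [← hsup, sup_eq_left.mpr ((Submodule.span_singleton_le_iff_mem _ _).mpr h)]
    · refine ⟨n + 1, ?_⟩
      rw [← hsup]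
      exact .step e hn h (Submodule.mem_sup_right (Submodule.mem_span_singleton_self _))

theorem exists_of_pow_smul_mem {N : ℕ} (hle : Q ≤ Q') (hfg : Q'.FG)
    (h : ∀ x ∈ Q', (p : WittVector p k) ^ N • x ∈ Q) : ∃ n, LatticeChain Q Q' n := by
  classical
  obtain ⟨s, hs⟩ := hfg
  have key : ∀ t : Finset L, (∀ x ∈ t, x ∈ Q') →
      ∃ n, LatticeChain Q (Q ⊔ Submodule.span _ (t : Set L)) n := by
    intro t
    induction t using Finset.induction_on with
    | empty =>
      intro _
      refine ⟨0, ?_⟩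
      rw [Finset.coe_empty, Submodule.span_empty, sup_bot_eq]
      exact .refl Q
    | insert e t _ ih =>
      intro ht
      obtain ⟨m, hm⟩ := ih fun x hx => ht x (Finset.mem_insert_of_mem hx)
      obtain ⟨n, hn⟩ := exists_sup_span (N := N)
        (hm.le (h e (ht e (Finset.mem_insert_self e t))))
      refine ⟨m + n, ?_⟩
      rw [Finset.coe_insert, Submodule.span_insert, sup_comm (Submodule.span _ {e}),
        ← sup_assoc]
      exact hm.trans hn
  obtain ⟨n, hn⟩ := key s fun x hx => hs ▸ Submodule.subset_span hx
  rw [hs, sup_eq_right.mpr hle] at hn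
  exact ⟨n, hn⟩

end LatticeChain

end Chains

/-! ### Enlarging the source: the dimension of the cokernel drops by at most the length -/

section QuotientChain

variable {p : ℕ} [Fact p.Prime] {k : Type*} [Field k] [IsAlgClosed k] [CharP k p]
  {P L : Type*} [AddCommGroup L] [Module (WittVector p k) L]
  [AddCommGroup P] [Module (WittVector p k) P]

/-- The image of the submodule `Q` under the difference of a `σ`-linear and a linear map. -/
noncomputable def imageSub (φ : P →ₛₗ[sigma p k] L) (ι : P →ₗ[WittVector p k] L)
    (Q : Submodule (WittVector p k) P) : AddSubgroup L :=
  Q.toAddSubgroup.map (φ.toAddMonoidHom - ι.toAddMonoidHom)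

theorem mem_imageSub {φ : P →ₛₗ[sigma p k] L} {ι : P →ₗ[WittVector p k] L}
    {Q : Submodule (WittVector p k) P} {y : L} :
    y ∈ imageSub φ ι Q ↔ ∃ x ∈ Q, φ x - ι x = y := Iff.rfl

/-- Write δ = φ - ι. Adjoining `e` to `Q` adds the points δ([t]e) to the image: w = [w₀] + p w', and
p e already lies in `Q`. For the same reason t ↦ δ([t]e) is additive modulo the old image, as [s] +
[t] - [s + t] is divisible by p. The new invariants are therefore the invariants of a one-parameter
subgroup. -/
theorem almostFinite_and_ringKrullDim_le_of_step (φ : P →ₛₗ[sigma p k] L)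
    (ι : P →ₗ[WittVector p k] L) (n : ℕ) {Q : Submodule (WittVector p k) P} {e : P}
    (hpe : (p : WittVector p k) • e ∈ Q)
    (hA : AlmostFinite (invariantFunctions p k (powSubgroup p L n ⊔ imageSub φ ι Q))) :
    AlmostFinite (invariantFunctions p k
      (powSubgroup p L n ⊔ imageSub φ ι (Q ⊔ Submodule.span _ {e}))) ∧
    ringKrullDim (invariantFunctions p k (powSubgroup p L n ⊔ imageSub φ ι Q)) ≤
      ringKrullDim (invariantFunctions p k
        (powSubgroup p L n ⊔ imageSub φ ι (Q ⊔ Submodule.span _ {e}))) + 1 := by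
  set H := powSubgroup p L n ⊔ imageSub φ ι Q with hH
  let θ : k → L := fun t =>
    φ (WittVector.teichmuller p t • e) - ι (WittVector.teichmuller p t • e)
  have hδ : ∀ x ∈ Q, φ x - ι x ∈ H := fun x hx => AddSubgroup.mem_sup_right ⟨x, hx, rfl⟩
  have hone : IsOneParameter p (invariantFunctions p k H) θ := by
    refine isOneParameter_invariantFunctions (n := n)
      (fun x => AddSubgroup.mem_sup_left (mem_powSubgroup.mpr ⟨x, rfl⟩)) (fun s t => ?_) fun l => ?_
    · obtain ⟨w', hw'⟩ := exists_eq_teichmuller_add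
        (WittVector.teichmuller p s + WittVector.teichmuller p t)
      have h0 : (WittVector.teichmuller p s + WittVector.teichmuller p t).coeff 0 = s + t := by
        rw [← WittVector.constantCoeff_apply, map_add]
        simp [WittVector.constantCoeff_apply]
      rw [h0] at hw'
      rw [← neg_mem_iff]
      convert hδ _ (p_smul_mem hpe w') using 1
      have h1 : (p * w') • e = WittVector.teichmuller p s • e + WittVector.teichmuller p t • e -
          WittVector.teichmuller p (s + t) • e := by
        rw [← add_smul, hw', add_smul, add_sub_cancel_left]
      rw [h1]
      simp only [θ, map_add, map_sub]
      abel
    · have hfrob : ∀ t : k, WittVector.frobenius (WittVector.teichmuller p t) =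
          WittVector.teichmuller p (t ^ p) := fun t => by
        rw [WittVector.frobenius_eq_map_frobenius, WittVector.map_teichmuller]
        rfl
      have h1 : ∀ t, l (θ t) = WittVector.teichmuller p (t ^ p) * l (φ e) -
          WittVector.teichmuller p t * l (ι e) := fun t => by
        simp only [θ, LinearMap.map_smulₛₗ, map_sub, map_smul, smul_eq_mul, hfrob]
      simp only [h1]
      exact ((WittRegular.teichmuller (Subalgebra.pow_mem _ snd_mem_polynomialFamilies p)).mul
        (.const _)).sub ((WittRegular.teichmuller snd_mem_polynomialFamilies).mul (.const _))
  have heq : thetaInvariants (invariantFunctions p k H) θ = invariantFunctions p k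
      (powSubgroup p L n ⊔ imageSub φ ι (Q ⊔ Submodule.span _ {e})) := by
    have hle : H ≤ powSubgroup p L n ⊔ imageSub φ ι (Q ⊔ Submodule.span _ {e}) :=
      sup_le_sup_left (AddSubgroup.map_mono (fun x hx => Submodule.mem_sup_left hx)) _
    ext f
    constructor
    · rintro ⟨hf, hfθ⟩
      refine ⟨hf.1, fun h hh x => ?_⟩
      obtain ⟨u, hu, v, hv, rfl⟩ := AddSubgroup.mem_sup.mp hh
      obtain ⟨y, hy, rfl⟩ := mem_imageSub.mp hv
      obtain ⟨q, hq, z, hz, rfl⟩ := Submodule.mem_sup.mp hy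
      obtain ⟨w, rfl⟩ := Submodule.mem_span_singleton.mp hz
      obtain ⟨w', hw'⟩ := exists_eq_teichmuller_add w
      have h1 := hδ _ (Q.add_mem hq (p_smul_mem hpe w'))
      have h2 := H.add_mem (AddSubgroup.mem_sup_left hu) h1
      have h4 := hfθ (w.coeff 0) (x + (u + (φ (q + (p * w') • e) - ι (q + (p * w') • e))))
      rw [hf.2 _ h2 x] at h4
      rw [← h4]
      congr 1
      have h3 : w • e = WittVector.teichmuller p (w.coeff 0) • e + (p * w') • e := by
        rw [← add_smul, ← hw']
      rw [h3]
      simp only [θ, map_add]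
      abel
    · intro hf
      refine ⟨⟨hf.1, fun h hh => hf.2 h (hle hh)⟩, fun t x => hf.2 _ ?_ x⟩
      exact AddSubgroup.mem_sup_right ⟨WittVector.teichmuller p t • e, Submodule.mem_sup_right
        (Submodule.smul_mem _ _ (Submodule.mem_span_singleton_self e)), rfl⟩
  have := hone.almostFinite_and_ringKrullDim_le hA
  rwa [heq] at this

theorem LatticeChain.almostFinite_and_ringKrullDim_le (φ : P →ₛₗ[sigma p k] L)
    (ι : P →ₗ[WittVector p k] L) (n : ℕ) {Q Q' : Submodule (WittVector p k) P} {m : ℕ}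
    (h : LatticeChain Q Q' m)
    (hA : AlmostFinite (invariantFunctions p k (powSubgroup p L n ⊔ imageSub φ ι Q))) :
    AlmostFinite (invariantFunctions p k (powSubgroup p L n ⊔ imageSub φ ι Q')) ∧
    ringKrullDim (invariantFunctions p k (powSubgroup p L n ⊔ imageSub φ ι Q)) ≤
      ringKrullDim (invariantFunctions p k (powSubgroup p L n ⊔ imageSub φ ι Q')) + m := by
  induction h with
  | refl => exact ⟨hA, by simp⟩
  | step e _ _ hpe ih =>
    obtain ⟨h1, h2⟩ := ih
    obtain ⟨h3, h4⟩ := almostFinite_and_ringKrullDim_le_of_step φ ι n hpe h1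
    refine ⟨h3, h2.trans ?_⟩
    push_cast
    rw [add_comm (_ : WithBot ℕ∞) (1 : WithBot ℕ∞), ← add_assoc]
    gcongr

/-- Start the chain at p^n P, whose image lies in p^n L and adds nothing to it; climb to `Q`, whose
image absorbs p^n L. -/
theorem almostFinite_invariantFunctions_imageSub [Module.Free (WittVector p k) L]
    [Module.Finite (WittVector p k) L] [Module.Finite (WittVector p k) P]
    (φ : P →ₛₗ[sigma p k] L) (ι : P →ₗ[WittVector p k] L) {n : ℕ}
    {Q : Submodule (WittVector p k) P}
    (hQ : ∀ x, (p : WittVector p k) ^ n • x ∈ Q) (hn : powSubgroup p L n ≤ imageSub φ ι Q) :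
    AlmostFinite (invariantFunctions p k (imageSub φ ι Q)) := by
  let Q₀ : Submodule (WittVector p k) P :=
    (⊤ : Submodule (WittVector p k) P).map (LinearMap.lsmul _ P ((p : WittVector p k) ^ n))
  have hQ₀ : Q₀ ≤ Q := by
    rintro _ ⟨x, -, rfl⟩
    exact hQ x
  have hH : powSubgroup p L n ⊔ imageSub φ ι Q₀ = powSubgroup p L n := by
    rw [sup_eq_left]
    rintro _ ⟨_, ⟨x, -, rfl⟩, rfl⟩
    refine ⟨φ x - ι x, ?_⟩
    change p ^ n • (φ x - ι x) = φ ((p : WittVector p k) ^ n • x) - ι ((p : WittVector p k) ^ n • x)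
    rw [pow_smul_eq_nsmul, map_nsmul, map_nsmul, smul_sub]
  have hfg : Q.FG := IsNoetherian.noetherian Q
  obtain ⟨m, hm⟩ := LatticeChain.exists_of_pow_smul_mem (N := n) hQ₀ hfg
    fun x _ => ⟨x, trivial, rfl⟩
  have hA := almostFinite_invariantFunctions_powSubgroup (p := p) (k := k) (L := L) n
  rw [← hH] at hA
  have := (hm.almostFinite_and_ringKrullDim_le φ ι n hA).1
  rwa [sup_eq_right.mpr hn] at this

end QuotientChain

/-! ### Enlarging the target: the dimension rises by at least the length -/

section Sublattices

variable {p : ℕ} [Fact p.Prime] {k : Type*} [Field k] [IsAlgClosed k] [CharP k p]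
  {L L' : Type*} [AddCommGroup L] [Module (WittVector p k) L]
  [AddCommGroup L'] [Module (WittVector p k) L']

theorem comp_linearMap_mem_wittFunctions (ι : L' →ₗ[WittVector p k] L) {f : L → k}
    (hf : f ∈ wittFunctions p k L) : (fun x => f (ι x)) ∈ wittFunctions p k L' :=
  wittFunctions_comp_mem rootClosed_wittFunctions (φ := ι)
    (fun l => wittRegular_dual (l.comp ι)) hf

/-- Composition of invariant functions with a linear map. -/
noncomputable def invariantComp (ι : L' →ₗ[WittVector p k] L) {H : AddSubgroup L'} {K : AddSubgroup L}
    (hHK : ∀ h ∈ H, ι h ∈ K) : invariantFunctions p k K →+* invariantFunctions p k H where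
  toFun f := ⟨fun x => (f : L → k) (ι x), comp_linearMap_mem_wittFunctions ι f.2.1,
    fun h hh x => by
      change (f : L → k) (ι (x + h)) = (f : L → k) (ι x)
      rw [map_add, f.2.2 _ (hHK h hh)]⟩
  map_one' := rfl
  map_mul' _ _ := rfl
  map_zero' := rfl
  map_add' _ _ := rfl

theorem ringKrullDim_invariantFunctions_le_of_equiv (ε : L' ≃ₗ[WittVector p k] L)
    {H : AddSubgroup L'} {K : AddSubgroup L} (hHK : ∀ h, h ∈ H ↔ ε h ∈ K) :
    ringKrullDim (invariantFunctions p k H) ≤ ringKrullDim (invariantFunctions p k K) := by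
  refine ringKrullDim_le_of_surjective
    (invariantComp (ε : L' →ₗ[WittVector p k] L) fun h hh => (hHK h).mp hh) fun g => ?_
  refine ⟨invariantComp (ε.symm : L →ₗ[WittVector p k] L')
    (fun h hh => (hHK _).mpr (by simpa using hh)) g, ?_⟩
  ext x
  exact congrArg (g : L' → k) (ε.symm_apply_apply x)

/-- Multiplication by p shifts Witt components and raises them to the p-th power, so division by p
preserves regularity on perfect groups. -/
theorem mem_of_pow_coeff_succ {S : Subalgebra k (L → k)} (hS : RootClosed p S)
    {a : L → WittVector p k} (ha : WittRegular S fun x => (p : WittVector p k) * a x) :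
    WittRegular S a := fun n => hS _ <| by
  convert ha (n + 1) using 1
  ext x
  change (a x).coeff n ^ p = ((p : WittVector p k) * a x).coeff (n + 1)
  rw [mul_comm (p : WittVector p k), WittVector.mul_charP_coeff_succ]

/-- The sublattice is the zero set of the function t, the constant component of a linear form l with
x ≡ l(x)e. The retraction x ↦ x - [t(x)]e shows that restriction of invariant functions to it is
surjective. As t is a nonzerodivisor in its kernel, the dimension drops by at least one on
restriction. -/
theorem ringKrullDim_succ_le_of_sublattice [Module.Projective (WittVector p k) L]
    {ι : L' →ₗ[WittVector p k] L} (hι : Function.Injective ι) {e : L}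
    (he : e ∉ LinearMap.range ι) (hpe : (p : WittVector p k) • e ∈ LinearMap.range ι)
    (hspan : ∀ x, ∃ w : WittVector p k, x - w • e ∈ LinearMap.range ι)
    {H : AddSubgroup L'} {K : AddSubgroup L} (hHK : ∀ h, h ∈ K ↔ ∃ x ∈ H, ι x = h) :
    ringKrullDim (invariantFunctions p k H) + 1 ≤ ringKrullDim (invariantFunctions p k K) := by
  -- a linear form `l` with `x - l x • e` in the range of `ι`
  obtain ⟨l, hl⟩ : ∃ l : L →ₗ[WittVector p k] WittVector p k,
      ∀ x, x - l x • e ∈ LinearMap.range ι := by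
    let g : WittVector p k →ₗ[WittVector p k] L ⧸ LinearMap.range ι :=
      (LinearMap.range ι).mkQ.comp (LinearMap.toSpanSingleton _ L e)
    have hg : Function.Surjective g := by
      intro y
      obtain ⟨x, rfl⟩ := Submodule.mkQ_surjective _ y
      obtain ⟨w, hw⟩ := hspan x
      exact ⟨w, ((Submodule.Quotient.eq _).mpr hw).symm⟩
    obtain ⟨l, hl⟩ := Module.projective_lifting_property g (LinearMap.range ι).mkQ hg
    refine ⟨l, fun x => (Submodule.Quotient.eq _).mp ?_⟩
    exact (LinearMap.congr_fun hl x).symm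
  have hcoeff : ∀ w : WittVector p k, w • e ∈ LinearMap.range ι → w.coeff 0 = 0 := by
    intro w hw
    by_contra h0
    exact he (mem_of_smul_mem_of_coeff_zero_ne_zero h0 hw)
  have hcoeff_add : ∀ a b : WittVector p k, (a + b).coeff 0 = a.coeff 0 + b.coeff 0 :=
    fun a b => by
      simp only [← WittVector.constantCoeff_apply, map_add]
  have hlι : ∀ x, (l (ι x)).coeff 0 = 0 := fun x => hcoeff _ <| by
    simpa using (LinearMap.range ι).sub_mem ⟨x, rfl⟩ (hl (ι x))
  have hle : (l e).coeff 0 = 1 := by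
    have h1 : (1 - l e).coeff 0 = 0 := hcoeff _ (by
      rw [sub_smul, one_smul]
      exact hl e)
    rw [← WittVector.constantCoeff_apply, map_sub, map_one, sub_eq_zero] at h1
    exact h1.symm
  let t : L → k := fun x => (l x).coeff 0
  have ht_add : ∀ x y, t (x + y) = t x + t y := fun x y => by
    simp only [t, map_add, hcoeff_add]
  have htι : ∀ x, t (ι x) = 0 := hlι
  have ht : t ∈ wittFunctions p k L := wittRegular_dual l 0
  have hρ : ∀ x, ∃ x', ι x' = x - WittVector.teichmuller p (t x) • e := by
    intro x
    obtain ⟨w', hw'⟩ := exists_eq_teichmuller_add (l x)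
    have h1 : x - WittVector.teichmuller p (t x) • e = x - l x • e + (p * w') • e := by
      conv_rhs => rw [hw', add_smul]
      abel
    rw [h1]
    exact (LinearMap.range ι).add_mem (hl x) (p_smul_mem hpe w')
  choose ρ hρ using hρ
  -- multiplication by `p` as a map to `L'`
  have hκ : ∀ x, ∃ x', ι x' = (p : WittVector p k) • x := by
    intro x
    obtain ⟨w, hw⟩ := hspan x
    have h1 : (p : WittVector p k) • x =
        (p : WittVector p k) • (x - w • e) + (p * w) • e := by
      rw [smul_sub, ← mul_smul, sub_add_cancel]
    rw [h1]
    exact (LinearMap.range ι).add_mem (Submodule.smul_mem _ _ hw) (p_smul_mem hpe w)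
  choose κ hκ using hκ
  let κ' : L →ₗ[WittVector p k] L' :=
    { toFun := κ
      map_add' := fun x y => hι (by rw [map_add, hκ, hκ, hκ, smul_add])
      map_smul' := fun c x => hι (by rw [map_smul, hκ, hκ, smul_comm]; rfl) }
  have hpρ : ∀ x, (p : WittVector p k) • ρ x =
      κ' x - WittVector.teichmuller p (t x) • κ' e := fun x => hι (by
    change ι _ = ι (κ x - _ • κ e)
    rw [map_smul, hρ, map_sub, map_smul, hκ, hκ, smul_sub, smul_comm])
  -- The retraction ρ is not linear, but p ρ is visibly regular when multiplication by p is viewed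
  -- as a linear map from `L` to `L'`; then divide by p.
  have hext : ∀ g ∈ wittFunctions p k L', (fun x => g (ρ x)) ∈ wittFunctions p k L := by
    intro g hg
    refine wittFunctions_comp_mem rootClosed_wittFunctions (fun l' => ?_) hg
    refine mem_of_pow_coeff_succ rootClosed_wittFunctions ?_
    have h1 : ∀ x, (p : WittVector p k) * l' (ρ x) =
        l' (κ' x) - WittVector.teichmuller p (t x) * l' (κ' e) := fun x => by
      rw [← smul_eq_mul, ← map_smul, hpρ, map_sub, map_smul, smul_eq_mul]
    simp only [h1]
    exact (wittRegular_dual (l'.comp κ')).sub ((WittRegular.teichmuller ht).mul (.const _))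
  have hρι : ∀ x, ρ (ι x) = x := fun x => hι (by
    rw [hρ, htι, WittVector.teichmuller_zero, zero_smul, sub_zero])
  have hρadd : ∀ x y, ρ (x + ι y) = ρ x + y := fun x y => hι (by
    rw [map_add, hρ, hρ, ht_add, htι, add_zero]
    abel)
  have htK : t ∈ invariantFunctions p k K := ⟨ht, fun h hh x => by
    obtain ⟨y, -, rfl⟩ := (hHK h).mp hh
    rw [ht_add, htι, add_zero]⟩
  refine ringKrullDim_succ_le_of_surjective
    (invariantComp ι fun h hh => (hHK _).mpr ⟨h, hh, rfl⟩) (fun g => ?_) (r := ⟨t, htK⟩)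
    (mem_nonZeroDivisors_iff_right.mpr fun f hf => ?_) (Subtype.ext (funext htι))
  · refine ⟨⟨fun x => (g : L' → k) (ρ x), hext _ g.2.1, fun h hh x => ?_⟩, ?_⟩
    · obtain ⟨y, hy, rfl⟩ := (hHK h).mp hh
      change (g : L' → k) (ρ (x + ι y)) = (g : L' → k) (ρ x)
      rw [hρadd, g.2.2 y hy]
    · ext x
      exact congrArg (g : L' → k) (hρι x)
  · have hft : ∀ x, (f : L → k) x * t x = 0 := fun x =>
      congrFun (congrArg (Subtype.val : _ → L → k) hf) x
    obtain ⟨m, Q, hQ⟩ := mem_polynomialFamilies.mp (wittFunctions_family_mem f.2.1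
      (θ := fun s => WittVector.teichmuller p s • e) fun l' => by
        simp only [map_smul, smul_eq_mul]
        exact (WittRegular.teichmuller snd_mem_polynomialFamilies).mul (.const _))
    have hts : ∀ x s, t (x + WittVector.teichmuller p s • e) = t x + s := by
      intro x s
      rw [ht_add]
      congr 1
      simp only [t, map_smul, smul_eq_mul]
      rw [← WittVector.constantCoeff_apply, map_mul]
      simp [WittVector.constantCoeff_apply, hle]
    ext x
    -- On the curve s ↦ x + [s]e the function t equals t(x) + s, so a function killed by t vanishes
    -- for all but one s, while a p-power of it is polynomial in s.
    have h1 : Q.map (evalAt _ x) * (X + Polynomial.C (t x)) = 0 := by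
      refine Polynomial.funext fun s => ?_
      have h2 := hft (x + WittVector.teichmuller p s • e)
      rw [hts] at h2
      rw [Polynomial.eval_mul, Polynomial.eval_map, ← hQ, Polynomial.eval_add, Polynomial.eval_X,
        Polynomial.eval_C, Polynomial.eval_zero]
      rcases mul_eq_zero.mp h2 with h | h
      · rw [h, zero_pow (pow_pos (Fact.out : p.Prime).pos m).ne', zero_mul]
      · rw [add_comm s, h, mul_zero]
    have h3 : Q.map (evalAt _ x) = 0 :=
      (mul_eq_zero.mp h1).resolve_right (Polynomial.X_add_C_ne_zero _)
    have h4 := hQ x 0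
    rw [← Polynomial.eval_map, h3, Polynomial.eval_zero, WittVector.teichmuller_zero, zero_smul,
      add_zero] at h4
    exact eq_zero_of_pow_eq_zero h4

/-- Each intermediate lattice Λ becomes the ambient module in turn, while the subgroup divided out
stays the same. -/
theorem LatticeChain.ringKrullDim_add_le [Module.Free (WittVector p k) L]
    [Module.Finite (WittVector p k) L] {j : L' →ₗ[WittVector p k] L}
    (hj : Function.Injective j) (H : AddSubgroup L') {R Λ : Submodule (WittVector p k) L} {n : ℕ}
    (hR : R = LinearMap.range j) (h : LatticeChain R Λ n) :
    ringKrullDim (invariantFunctions p k H) + n ≤ ringKrullDim (invariantFunctions p k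
      ((H.map j.toAddMonoidHom).comap Λ.subtype.toAddMonoidHom)) := by
  induction h with
  | refl =>
    subst hR
    rw [Nat.cast_zero, add_zero]
    refine ringKrullDim_invariantFunctions_le_of_equiv (LinearEquiv.ofInjective j hj) fun h => ?_
    constructor
    · exact fun hh => ⟨h, hh, rfl⟩
    · rintro ⟨h', hh', heq⟩
      rwa [← hj heq]
  | @step Λ n e hc he hpe ih =>
    push_cast
    rw [← add_assoc]
    refine (add_le_add_left ih 1).trans ?_
    have hle : Λ ≤ Λ ⊔ Submodule.span (WittVector p k) {e} := le_sup_left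
    have heΛ : e ∈ Λ ⊔ Submodule.span (WittVector p k) {e} :=
      Submodule.mem_sup_right (Submodule.mem_span_singleton_self e)
    have hrange : ∀ y : (Λ ⊔ Submodule.span (WittVector p k) {e} : Submodule _ L),
        y ∈ LinearMap.range (Submodule.inclusion hle) ↔ (y : L) ∈ Λ := fun y => by
      constructor
      · rintro ⟨x, rfl⟩
        exact x.2
      · exact fun hy => ⟨⟨y, hy⟩, rfl⟩
    refine ringKrullDim_succ_le_of_sublattice (Submodule.inclusion_injective hle)
      (e := ⟨e, heΛ⟩) ?_ ?_ (fun x => ?_) (fun h => ?_)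
    · rwa [hrange]
    · rwa [hrange]
    · obtain ⟨x, hx⟩ := x
      obtain ⟨q, hq, z, hz, rfl⟩ := Submodule.mem_sup.mp hx
      obtain ⟨w, rfl⟩ := Submodule.mem_span_singleton.mp hz
      refine ⟨w, (hrange _).mpr ?_⟩
      simpa using hq
    · constructor
      · rintro ⟨x, hx, hxh⟩
        have hxΛ : j x ∈ Λ := hc.le (hR ▸ ⟨x, rfl⟩)
        exact ⟨⟨j x, hxΛ⟩, ⟨x, hx, rfl⟩, Subtype.ext hxh⟩
      · rintro ⟨y, ⟨x, hx, hxy⟩, rfl⟩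
        exact ⟨x, hx, hxy⟩

/-- Enlarging the lattice by a module of length `n` increases the dimension by at least `n`. -/
theorem LatticeChain.ringKrullDim_add_le_map [Module.Free (WittVector p k) L]
    [Module.Finite (WittVector p k) L] {j : L' →ₗ[WittVector p k] L}
    (hj : Function.Injective j) (H : AddSubgroup L') {n : ℕ}
    (h : LatticeChain (LinearMap.range j) ⊤ n) :
    ringKrullDim (invariantFunctions p k H) + n ≤
      ringKrullDim (invariantFunctions p k (H.map j.toAddMonoidHom)) :=
  (h.ringKrullDim_add_le hj H rfl).trans <|
    ringKrullDim_invariantFunctions_le_of_equiv Submodule.topEquiv fun _ => Iff.rfl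

end Sublattices

/-! ### Dimension of 𝐔_L under quasi-isogenies -/

namespace FCrystal

universe u v w

variable {p : ℕ} [Fact p.Prime] {k : Type u} [Field k] [IsAlgClosed k] [CharP k p]
  (L : FCrystal.{u, v} p k)

/-- The `σ`-linear map `F / p`. -/
noncomputable def divF : L.nygaard →ₛₗ[sigma p k] L where
  toFun := L.divFrobenius
  map_add' := map_add _
  map_smul' c x := p_smul_injective L <| by
    change (p : WittVector p k) • L.divFrobenius (c • x) =
      (p : WittVector p k) • (sigma p k c • L.divFrobenius x)
    rw [p_smul_divFrobenius, smul_comm, p_smul_divFrobenius, Submodule.coe_smul,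
      LinearMap.map_smulₛₗ]

theorem p_smul_divF (x : L.nygaard) : (p : WittVector p k) • L.divF x = L.F x :=
  L.p_smul_divFrobenius x

theorem range_divFrobeniusSubOne :
    L.divFrobeniusSubOne.range = imageSub L.divF L.nygaard.subtype ⊤ := by
  ext y
  constructor
  · rintro ⟨x, rfl⟩
    exact ⟨x, trivial, rfl⟩
  · rintro ⟨x, -, rfl⟩
    exact ⟨x, rfl⟩

theorem toU_add_range (x : L) {h : L} (hh : h ∈ L.divFrobeniusSubOne.range) :
    L.toU (x + h) = L.toU x := by
  have h0 : L.toU h = 0 := (QuotientAddGroup.eq_zero_iff h).mpr hh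
  rw [map_add, h0, add_zero]

/-- The pull-back of regular functions from `𝐔_L` to `𝐋`. -/
noncomputable def pullbackU :
    L.regularFunctionsU →+* invariantFunctions p k L.divFrobeniusSubOne.range where
  toFun g := ⟨fun x => (g : L.U → k) (L.toU x), g.2, fun _ hh x =>
    congrArg (g : L.U → k) (L.toU_add_range x hh)⟩
  map_one' := rfl
  map_mul' _ _ := rfl
  map_zero' := rfl
  map_add' _ _ := rfl

theorem pullbackU_bijective : Function.Bijective L.pullbackU := by
  have hs : Function.Surjective L.toU := QuotientAddGroup.mk'_surjective _
  constructor
  · intro f g hfg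
    ext u
    obtain ⟨x, rfl⟩ := hs u
    exact congrFun (congrArg Subtype.val hfg) x
  · intro f
    choose s hs using hs
    have hfs : ∀ x, (f : L → k) (s (L.toU x)) = (f : L → k) x := fun x =>
      invariantFunctions_eq_of_sub_mem f.2 <| (QuotientAddGroup.eq_zero_iff _).mp <| by
        change L.toU (s (L.toU x) - x) = 0
        rw [map_sub, hs, sub_self]
    refine ⟨⟨fun u => (f : L → k) (s u), ?_⟩, Subtype.ext (funext hfs)⟩
    rw [mem_regularFunctionsU]
    simp only [hfs]
    exact f.2.1

theorem dimU_eq :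
    L.dimU = ringKrullDim (invariantFunctions p k (imageSub L.divF L.nygaard.subtype ⊤)) := by
  rw [← range_divFrobeniusSubOne]
  exact ringKrullDim_eq_of_ringEquiv (RingEquiv.ofBijective L.pullbackU L.pullbackU_bijective)

theorem p_smul_mem_nygaard (x : L) : (p : WittVector p k) • x ∈ L.nygaard :=
  ⟨L.F x, by rw [LinearMap.map_smulₛₗ, map_natCast]⟩

theorem divF_p_smul (x : L) : L.divF ⟨_, L.p_smul_mem_nygaard x⟩ = L.F x :=
  p_smul_injective L <| by
    change (p : WittVector p k) • _ = (p : WittVector p k) • _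
    rw [p_smul_divF, LinearMap.map_smulₛₗ, map_natCast]

/-- On an element p w of F¹_N(L) the map F/p - 1 takes the value F w - p w, so openness of the image
of F - p applies. The bound n depends on `Q` only through `c`. -/
theorem exists_powSubgroup_le_imageSub (c : ℕ) : ∃ n, c ≤ n ∧
    ∀ Q : Submodule (WittVector p k) L.nygaard, (∀ x, (p : WittVector p k) ^ c • x ∈ Q) →
      powSubgroup p L n ≤ imageSub L.divF L.nygaard.subtype Q := by
  obtain ⟨n, hn⟩ := exists_powSubgroup_le_range L.F
  refine ⟨c + n, c.le_add_right n, fun Q hQ => ?_⟩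
  rintro _ ⟨z, rfl⟩
  obtain ⟨w, hw⟩ := hn ⟨z, rfl⟩
  refine mem_imageSub.mpr ⟨_, hQ ⟨_, L.p_smul_mem_nygaard w⟩, ?_⟩
  change _ = p ^ (c + n) • z
  change L.F w - p • w = p ^ n • z at hw
  rw [pow_add, mul_smul, ← hw, pow_smul_eq_nsmul, map_nsmul, map_nsmul, divF_p_smul,
    Submodule.subtype_apply, smul_sub, ← p_smul_eq_nsmul (k := k) w]

theorem almostFinite_imageSub {c : ℕ} {Q : Submodule (WittVector p k) L.nygaard}
    (hQ : ∀ x, (p : WittVector p k) ^ c • x ∈ Q) :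
    AlmostFinite (invariantFunctions p k (imageSub L.divF L.nygaard.subtype Q)) := by
  obtain ⟨n, hcn, hn⟩ := L.exists_powSubgroup_le_imageSub c
  refine almostFinite_invariantFunctions_imageSub _ _ (n := n) (fun x => ?_) (hn Q hQ)
  obtain ⟨d, rfl⟩ := Nat.exists_eq_add_of_le hcn
  rw [add_comm, pow_add, mul_smul]
  exact Q.smul_mem _ (hQ x)

theorem exists_dimU_eq : ∃ d : ℕ, L.dimU = d := by
  obtain ⟨d, hd, -⟩ :=
    (L.almostFinite_imageSub (c := 0) (Q := ⊤) fun _ => trivial).exists_ringKrullDim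
  exact ⟨d, L.dimU_eq.trans hd⟩

/-- Enlarging the source of `F / p - 1` by a module of length `m` decreases the dimension of the
cokernel by at most `m`. -/
theorem ringKrullDim_imageSub_le {c m : ℕ} {Q : Submodule (WittVector p k) L.nygaard}
    (hQ : ∀ x, (p : WittVector p k) ^ c • x ∈ Q) (hm : LatticeChain Q ⊤ m) :
    ringKrullDim (invariantFunctions p k (imageSub L.divF L.nygaard.subtype Q)) ≤
      L.dimU + m := by
  obtain ⟨n, -, hn⟩ := L.exists_powSubgroup_le_imageSub c
  have h1 : powSubgroup p L n ⊔ imageSub L.divF L.nygaard.subtype Q =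
      imageSub L.divF L.nygaard.subtype Q := sup_eq_right.mpr (hn Q hQ)
  have h2 : powSubgroup p L n ⊔ imageSub L.divF L.nygaard.subtype ⊤ =
      imageSub L.divF L.nygaard.subtype ⊤ := sup_eq_right.mpr (hn ⊤ fun _ => trivial)
  have h3 := (hm.almostFinite_and_ringKrullDim_le L.divF L.nygaard.subtype n
    (by rw [h1]; exact L.almostFinite_imageSub hQ)).2
  rwa [h1, h2, ← dimU_eq] at h3

variable {L} {L' : FCrystal.{u, w} p k}

theorem map_mem_nygaard {j : L' →ₗ[WittVector p k] L} (hF : ∀ x, j (L'.F x) = L.F (j x)) {x : L'}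
    (hx : x ∈ L'.nygaard) : j x ∈ L.nygaard := by
  obtain ⟨y, hy⟩ := hx
  exact ⟨j y, by rw [← map_smul, hy, hF]⟩

/-- Through j the image of F/p - 1 for `L'` is the image for `L` of the sublattice `Q` = j F¹_N(L').
Passing from jL' to `L` and from `Q` to F¹_N(L) changes the dimension in opposite directions, by at
least n and at most m respectively. -/
theorem dimU_le_of_quasiIsogeny {j : L' →ₗ[WittVector p k] L} {j' : L →ₗ[WittVector p k] L'}
    {N : ℕ} (hj : Function.Injective j) (hjj' : ∀ x, j (j' x) = (p : WittVector p k) ^ N • x)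
    (hF : ∀ x, j (L'.F x) = L.F (j x)) (hF' : ∀ x, j' (L.F x) = L'.F (j' x)) {h : ℕ}
    (hL : LatticeChain L.nygaard ⊤ h) (hL' : LatticeChain L'.nygaard ⊤ h) :
    L'.dimU ≤ L.dimU := by
  let Q : Submodule (WittVector p k) L.nygaard := (L'.nygaard.map j).comap L.nygaard.subtype
  have hQ : ∀ x, (p : WittVector p k) ^ N • x ∈ Q := fun x =>
    ⟨j' x, map_mem_nygaard hF' x.2, hjj' x⟩
  have hQmap : Q.map L.nygaard.subtype = L'.nygaard.map j := by
    rw [Submodule.map_comap_subtype, inf_eq_right]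
    rintro _ ⟨x, hx, rfl⟩
    exact map_mem_nygaard hF hx
  obtain ⟨m, hm⟩ := LatticeChain.exists_of_pow_smul_mem (N := N) (le_top : Q ≤ ⊤)
    (IsNoetherian.noetherian _) fun x _ => hQ x
  obtain ⟨n, hn⟩ := LatticeChain.exists_of_pow_smul_mem (N := N)
    (le_top : LinearMap.range j ≤ ⊤) (IsNoetherian.noetherian _) fun x _ => ⟨j' x, hjj' x⟩
  -- The length of L / j F¹_N(L') is m + h through F¹_N(L), and h + n through jL'.
  have hmn : m = n := by
    have h1 := hm.map L.nygaard.subtype L.nygaard.injective_subtype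
    rw [hQmap, Submodule.map_top, Submodule.range_subtype] at h1
    have h2 := hL'.map j hj
    rw [Submodule.map_top] at h2
    have := (h1.trans hL).length_unique (h2.trans hn)
    omega
  subst hmn
  have hdiv : ∀ (x : L') (hx : x ∈ L'.nygaard),
      L.divF ⟨j x, map_mem_nygaard hF hx⟩ = j (L'.divF ⟨x, hx⟩) := fun x hx =>
    p_smul_injective L <| by
      change (p : WittVector p k) • _ = (p : WittVector p k) • _
      rw [p_smul_divF, ← map_smul, p_smul_divF, hF]
  have himage : (imageSub L'.divF L'.nygaard.subtype ⊤).map j.toAddMonoidHom =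
      imageSub L.divF L.nygaard.subtype Q := by
    ext y
    constructor
    · rintro ⟨_, ⟨⟨x, hx⟩, -, rfl⟩, rfl⟩
      refine mem_imageSub.mpr ⟨⟨j x, map_mem_nygaard hF hx⟩, ⟨x, hx, rfl⟩, ?_⟩
      rw [hdiv x hx]
      exact (map_sub j _ _).symm
    · rintro ⟨⟨_, _⟩, ⟨x, hx, rfl⟩, rfl⟩
      refine ⟨_, ⟨⟨x, hx⟩, trivial, rfl⟩, ?_⟩
      refine (map_sub j _ _).trans ?_
      exact congrArg (· - j x) (hdiv x hx).symm
  have h1 := hn.ringKrullDim_add_le_map hj (imageSub L'.divF L'.nygaard.subtype ⊤)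
  rw [himage, ← dimU_eq] at h1
  have h2 := h1.trans (L.ringKrullDim_imageSub_le hQ hm)
  -- Both dimensions are finite, so the common length can be cancelled.
  obtain ⟨d, hd⟩ := L.exists_dimU_eq
  obtain ⟨d', hd'⟩ := L'.exists_dimU_eq
  rw [hd, hd'] at h2 ⊢
  norm_cast at h2 ⊢
  omega

/-- The dimension of `𝐔_L` is invariant under quasi-isogenies which preserve the length of
`L / F¹_N(L)`. -/
theorem dimU_eq_of_quasiIsogeny {j : L' →ₗ[WittVector p k] L} {j' : L →ₗ[WittVector p k] L'}
    {N : ℕ} (hjj' : ∀ x, j (j' x) = (p : WittVector p k) ^ N • x)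
    (hj'j : ∀ x, j' (j x) = (p : WittVector p k) ^ N • x)
    (hF : ∀ x, j (L'.F x) = L.F (j x)) (hF' : ∀ x, j' (L.F x) = L'.F (j' x)) {h : ℕ}
    (hL : LatticeChain L.nygaard ⊤ h) (hL' : LatticeChain L'.nygaard ⊤ h) :
    L'.dimU = L.dimU := by
  have hp : (p : WittVector p k) ^ N ≠ 0 := pow_ne_zero _ (WittVector.p_nonzero p k)
  have hj : Function.Injective j := fun x y hxy =>
    smul_right_injective L' hp (by simpa only [hj'j] using congrArg j' hxy)
  have hj' : Function.Injective j' := fun x y hxy =>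
    smul_right_injective L hp (by simpa only [hjj'] using congrArg j hxy)
  exact le_antisymm (dimU_le_of_quasiIsogeny hj hjj' hF hF' hL hL')
    (dimU_le_of_quasiIsogeny hj' hj'j hF' hF hL' hL)

end FCrystal

/-! ### Diagonal forms of F and the length of L / F¹_N(L) -/

section DiagonalForms

variable {p : ℕ} [Fact p.Prime] {k : Type*} [Field k] [IsAlgClosed k] [CharP k p]
  {L : Type*} [AddCommGroup L] [Module (WittVector p k) L]

/-- A diagonal form of a `σ`-linear endomorphism: bases `b`, `u` with `F (b i) = a i • u i`. -/
structure DiagonalForm (F : L →ₛₗ[sigma p k] L) (I : Type*) where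
  /-- The basis of the source. -/
  b : Module.Basis I (WittVector p k) L
  /-- The basis of the target. -/
  u : Module.Basis I (WittVector p k) L
  /-- The diagonal entries. -/
  a : I → WittVector p k
  map_b : ∀ i, F (b i) = a i • u i

open scoped Classical in
/-- The indices of the diagonal entries not divisible by `p`. -/
noncomputable def DiagonalForm.units {F : L →ₛₗ[sigma p k] L} {I : Type*} [Fintype I]
    (D : DiagonalForm F I) : Finset I :=
  {i | ¬ (p : WittVector p k) ∣ D.a i}

theorem DiagonalForm.mem_units {F : L →ₛₗ[sigma p k] L} {I : Type*} [Fintype I]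
    {D : DiagonalForm F I} {i : I} : i ∈ D.units ↔ ¬ (p : WittVector p k) ∣ D.a i := by
  simp [units]

theorem prime_p : Prime (p : WittVector p k) :=
  (WittVector.irreducible p).prime

theorem DiagonalForm.repr_apply {F : L →ₛₗ[sigma p k] L} {I : Type*} [Fintype I]
    (D : DiagonalForm F I) (x : L) (i : I) :
    D.u.repr (F x) i = sigma p k (D.b.repr x i) * D.a i := by
  classical
  conv_lhs => rw [← D.b.sum_repr x]
  simp only [map_sum, LinearMap.map_smulₛₗ, D.map_b, map_smul, Finsupp.coe_finsetSum,
    Finset.sum_apply, Finsupp.smul_apply, smul_eq_mul, Module.Basis.repr_self]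
  rw [Finset.sum_eq_single i]
  · simp
  · intro j _ hj
    simp [Finsupp.single_eq_of_ne hj.symm]
  · simp

theorem p_dvd_of_p_dvd_sigma {a : WittVector p k} (h : (p : WittVector p k) ∣ sigma p k a) :
    (p : WittVector p k) ∣ a := by
  obtain ⟨c, hc⟩ := h
  obtain ⟨d, rfl⟩ := (WittVector.frobeniusEquiv p k).surjective c
  refine ⟨d, (WittVector.frobeniusEquiv p k).injective ?_⟩
  rw [map_mul, map_natCast]
  exact hc

end DiagonalForms

namespace FCrystal

universe u v w

variable {p : ℕ} [Fact p.Prime] {k : Type u} [Field k] [IsAlgClosed k] [CharP k p]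
  (L : FCrystal.{u, v} p k)

/-- In the source basis, F¹_N(L) is cut out by divisibility by p of the coordinates at the unit
entries; adjoining those basis vectors one at a time gives the chain. -/
theorem latticeChain_nygaard {I : Type*} [Fintype I] (D : DiagonalForm L.F I) :
    LatticeChain L.nygaard ⊤ D.units.card := by
  classical
  have hdvd : ∀ x ∈ L.nygaard, ∀ i ∈ D.units, (p : WittVector p k) ∣ D.b.repr x i := by
    rintro x ⟨y, hy⟩ i hi
    have h1 := D.repr_apply x i
    rw [← hy, map_smul, Finsupp.smul_apply, smul_eq_mul] at h1
    exact p_dvd_of_p_dvd_sigma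
      ((prime_p.dvd_or_dvd ⟨_, h1.symm⟩).resolve_right (DiagonalForm.mem_units.mp hi))
  have hchain : ∀ S : Finset I, S ⊆ D.units →
      LatticeChain L.nygaard (L.nygaard ⊔ Submodule.span _ (D.b '' S)) S.card := by
    intro S
    induction S using Finset.induction_on with
    | empty =>
      intro _
      simpa using LatticeChain.refl L.nygaard
    | insert i S hi ih =>
      intro hS
      rw [Finset.insert_subset_iff] at hS
      have hspan : L.nygaard ⊔ Submodule.span (WittVector p k) (D.b '' (insert i S : Finset I)) =
          L.nygaard ⊔ Submodule.span _ (D.b '' S) ⊔ Submodule.span _ {D.b i} := by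
        rw [Finset.coe_insert, Set.image_insert_eq, Submodule.span_insert, sup_assoc,
          sup_comm (Submodule.span _ {D.b i})]
      rw [hspan, Finset.card_insert_of_notMem hi]
      refine .step (D.b i) (ih hS.2) (fun h => ?_)
        (Submodule.mem_sup_left (L.p_smul_mem_nygaard _))
      obtain ⟨x, hx, y, hy, hxy⟩ := Submodule.mem_sup.mp h
      have hy0 : D.b.repr y i = 0 := by
        rw [← Finsupp.notMem_support_iff]
        exact fun hiy => hi (D.b.mem_span_image.mp hy hiy)
      have h1 := hdvd x hx i hS.1
      have h2 : D.b.repr x i = 1 := by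
        rw [← add_zero (D.b.repr x i), ← hy0, ← Finsupp.add_apply, ← map_add, hxy,
          Module.Basis.repr_self, Finsupp.single_eq_same]
      rw [h2] at h1
      exact prime_p.not_isUnit (isUnit_of_dvd_one h1)
  have htop : L.nygaard ⊔ Submodule.span (WittVector p k) (D.b '' D.units) = ⊤ := by
    rw [eq_top_iff, ← D.b.span_eq, Submodule.span_le]
    rintro _ ⟨i, rfl⟩
    by_cases hi : i ∈ D.units
    · exact Submodule.mem_sup_right (Submodule.subset_span ⟨i, hi, rfl⟩)
    · obtain ⟨c, hc⟩ := not_not.mp (fun h => hi (DiagonalForm.mem_units.mpr h))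
      exact Submodule.mem_sup_left ⟨c • D.u i, by rw [D.map_b, hc, mul_smul]⟩
  have := hchain D.units subset_rfl
  rwa [htop] at this

end FCrystal

/-! ### Existence of diagonal forms for Dieudonné modules -/

namespace DieudonneModule

universe u v w

variable {p : ℕ} [Fact p.Prime] {k : Type u} [Field k] [IsAlgClosed k] [CharP k p]
  (M : DieudonneModule.{u, v} p k)

theorem F_injective : Function.Injective M.F := fun x y h =>
  p_smul_injective M (by simpa only [M.V_F] using congrArg M.V h)

theorem V_injective : Function.Injective M.V := fun x y h =>
  p_smul_injective M (by simpa only [M.F_V] using congrArg M.F h)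

/-- The F-crystal underlying a Dieudonné module. -/
def toFCrystal : FCrystal.{u, v} p k where
  carrier := M
  F := M.F
  F_injective := M.F_injective

instance : RingHomSurjective (sigma p k) := ⟨(WittVector.frobeniusEquiv p k).surjective⟩

instance : RingHomSurjective (sigmaInv p k) :=
  ⟨(WittVector.frobeniusEquiv p k).symm.surjective⟩

theorem nygaard_toFCrystal :
    (M.toFCrystal).nygaard = (⊤ : Submodule (WittVector p k) M).map M.V := by
  ext x
  constructor
  · rintro ⟨y, hy⟩
    exact ⟨y, trivial, M.F_injective ((M.F_V y).trans hy)⟩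
  · rintro ⟨y, -, rfl⟩
    exact ⟨y, (M.F_V y).symm⟩

/-- Apply Smith normal form to FM ⊆ M and pull the basis of FM back along the σ-linear bijection M →
FM, which also shows that FM has full rank. -/
theorem exists_diagonalForm : ∃ n : ℕ, Nonempty (DiagonalForm M.F (Fin n)) := by
  let b₀ := Module.finBasis (WittVector p k) M
  refine ⟨Module.finrank (WittVector p k) M, ?_⟩
  let N : Submodule (WittVector p k) M := (⊤ : Submodule (WittVector p k) M).map M.F
  let ε : M ≃+ N := AddEquiv.ofBijective
    (M.F.toAddMonoidHom.codRestrict N.toAddSubgroup fun x => ⟨x, trivial, rfl⟩)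
    ⟨fun x y h => M.F_injective (congrArg Subtype.val h), by
      rintro ⟨_, x, -, rfl⟩
      exact ⟨x, rfl⟩⟩
  have hε : ∀ x, (ε x : M) = M.F x := fun x => rfl
  have hrank : Module.finrank (WittVector p k) N = Module.finrank (WittVector p k) M := by
    unfold Module.finrank
    rw [rank_eq_of_equiv_equiv (sigma p k) ε (WittVector.frobeniusEquiv p k).bijective
      fun r m => Subtype.ext ?_]
    rw [hε, LinearMap.map_smulₛₗ]
    rfl
  obtain ⟨u, a, b', hb'⟩ := N.exists_smith_normal_form_of_rank_eq b₀ hrank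
  have hFb : ∀ i, M.F (ε.symm (b' i)) = a i • u i := fun i => by
    rw [← hε, ε.apply_symm_apply, hb']
  have hsum : ∀ c : Fin (Module.finrank (WittVector p k) M) → WittVector p k,
      ε (∑ i, c i • ε.symm (b' i)) = ∑ i, sigma p k (c i) • b' i := fun c => by
    rw [map_sum]
    refine Finset.sum_congr rfl fun i _ => Subtype.ext ?_
    rw [hε, LinearMap.map_smulₛₗ, ← hε, ε.apply_symm_apply]
    rfl
  refine ⟨⟨Module.Basis.mk (v := fun i => ε.symm (b' i)) ?_ ?_, u, a, fun i => ?_⟩⟩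
  · rw [Fintype.linearIndependent_iff]
    intro c hc i
    have h1 := hsum c
    rw [hc, map_zero] at h1
    have h2 := Fintype.linearIndependent_iff.mp b'.linearIndependent _ h1.symm i
    exact (WittVector.frobeniusEquiv p k).injective (h2.trans (map_zero _).symm)
  · intro x _
    have h1 : x = ∑ i, (sigmaInv p k (b'.repr (ε x) i)) • ε.symm (b' i) := by
      apply ε.injective
      rw [hsum]
      conv_lhs => rw [← b'.sum_repr (ε x)]
      refine Finset.sum_congr rfl fun i _ => ?_
      congr 1
      exact ((WittVector.frobeniusEquiv p k).apply_symm_apply _).symm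
    rw [h1]
    exact Submodule.sum_mem _ fun i _ =>
      Submodule.smul_mem _ _ (Submodule.subset_span ⟨i, rfl⟩)
  · rw [Module.Basis.mk_apply, hFb]

end DieudonneModule

/-! ### Isogenies, numbers of unit entries, and the conclusion -/

namespace DieudonneModule

universe u v w v' w'

variable {p : ℕ} [Fact p.Prime] {k : Type u} [Field k] [IsAlgClosed k] [CharP k p]
  {M : DieudonneModule.{u, v} p k} {M' : DieudonneModule.{u, w} p k}
  {N : DieudonneModule.{u, v'} p k} {N' : DieudonneModule.{u, w'} p k}

/-- The canonical map `M → K ⊗_W M`. -/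
noncomputable def toRational (M : DieudonneModule.{u, v} p k) : M →ₗ[WittVector p k] M.Rational :=
  TensorProduct.mk (WittVector p k) (FractionRing (WittVector p k)) M 1

theorem toRational_injective (M : DieudonneModule.{u, v} p k) :
    Function.Injective M.toRational := fun x y hxy => by
  have h := Module.Flat.rTensor_preserves_injective_linearMap (M := M)
    (Algebra.linearMap (WittVector p k) (FractionRing (WittVector p k)))
    (IsFractionRing.injective _ _)
  refine (TensorProduct.lid (WittVector p k) M).symm.injective (h ?_)
  rw [TensorProduct.lid_symm_apply, TensorProduct.lid_symm_apply, LinearMap.rTensor_tmul,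
    LinearMap.rTensor_tmul, Algebra.linearMap_apply, map_one]
  exact hxy

theorem rationalF_toRational (x : M) : M.rationalF (M.toRational x) = M.toRational (M.F x) := by
  change TensorProduct.map fracSigma M.F (1 ⊗ₜ x) = 1 ⊗ₜ M.F x
  rw [TensorProduct.map_tmul]
  congr 1
  exact map_one (WittVector.FractionRing.frobenius p k)

theorem rationalV_toRational (x : M) : M.rationalV (M.toRational x) = M.toRational (M.V x) := by
  change TensorProduct.map fracSigmaInv M.V (1 ⊗ₜ x) = 1 ⊗ₜ M.V x
  rw [TensorProduct.map_tmul]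
  congr 1
  exact map_one (WittVector.FractionRing.frobenius p k).symm

theorem exists_pow_smul_eq_algebraMap (q : FractionRing (WittVector p k)) :
    ∃ (n : ℕ) (c : WittVector p k),
      (p : WittVector p k) ^ n • q = algebraMap _ (FractionRing (WittVector p k)) c := by
  obtain ⟨a, b, hb, rfl⟩ := IsFractionRing.div_surjective (A := WittVector p k) q
  obtain ⟨n, c, rfl⟩ := WittVector.exists_eq_pow_p_mul' b (nonZeroDivisors.ne_zero hb)
  have hb' := IsFractionRing.to_map_ne_zero_of_mem_nonZeroDivisors
    (K := FractionRing (WittVector p k)) hb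
  refine ⟨n, a * (c⁻¹ : (WittVector p k)ˣ), ?_⟩
  rw [Algebra.smul_def, mul_div_assoc', div_eq_iff hb', ← map_mul, ← map_mul]
  congr 1
  linear_combination (-a * (p : WittVector p k) ^ n) * c.inv_mul

theorem exists_pow_smul_eq_toRational (z : M.Rational) :
    ∃ (n : ℕ) (y : M), (p : WittVector p k) ^ n • z = M.toRational y := by
  induction z using TensorProduct.induction_on with
  | zero => exact ⟨0, 0, by simp⟩
  | tmul q x =>
    obtain ⟨n, c, hc⟩ := exists_pow_smul_eq_algebraMap q
    refine ⟨n, c • x, ?_⟩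
    rw [TensorProduct.smul_tmul', hc, Algebra.algebraMap_eq_smul_one, TensorProduct.smul_tmul]
    rfl
  | add z z' hz hz' =>
    obtain ⟨n, y, hy⟩ := hz
    obtain ⟨n', y', hy'⟩ := hz'
    refine ⟨n + n', (p : WittVector p k) ^ n' • y + (p : WittVector p k) ^ n • y', ?_⟩
    rw [map_add, map_smul, map_smul, ← hy, ← hy', smul_add, ← mul_smul, ← mul_smul, ← pow_add,
      ← pow_add, add_comm n' n]

/-- Finite generation allows one power of p to clear the denominators of the images of all basis
vectors. -/
theorem exists_lift (f : M.Rational →ₗ[WittVector p k] M'.Rational) :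
    ∃ (n : ℕ) (j : M →ₗ[WittVector p k] M'),
      ∀ x, M'.toRational (j x) = (p : WittVector p k) ^ n • f (M.toRational x) := by
  let b := Module.finBasis (WittVector p k) M
  choose n y hy using fun i => exists_pow_smul_eq_toRational (f (M.toRational (b i)))
  have hmem : ∀ x, ∃ z, M'.toRational z =
      (p : WittVector p k) ^ (∑ i, n i) • f (M.toRational x) := by
    intro x
    have hx : x ∈ Submodule.span (WittVector p k) (Set.range b) := b.mem_span x
    induction hx using Submodule.span_induction with
    | zero => exact ⟨0, by simp⟩
    | add x x' _ _ h h' =>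
      obtain ⟨z, hz⟩ := h
      obtain ⟨z', hz'⟩ := h'
      exact ⟨z + z', by rw [map_add, hz, hz', map_add, map_add, smul_add]⟩
    | smul c x _ h =>
      obtain ⟨z, hz⟩ := h
      exact ⟨c • z, by rw [map_smul, hz, map_smul, map_smul, smul_comm]⟩
    | mem x hx =>
      obtain ⟨i, rfl⟩ := hx
      refine ⟨(p : WittVector p k) ^ (∑ i ∈ Finset.univ.erase i, n i) • y i, ?_⟩
      rw [map_smul, ← hy, ← mul_smul, ← pow_add, Finset.sum_erase_add _ _ (Finset.mem_univ i)]
  choose j hj using hmem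
  have hinj := M'.toRational_injective
  exact ⟨∑ i, n i,
    { toFun := j
      map_add' := fun x x' => hinj (by
        rw [map_add, hj, hj, hj, map_add, map_add, smul_add])
      map_smul' := fun c x => hinj (by
        rw [map_smul, hj, hj, map_smul, map_smul, smul_comm]; rfl) }, hj⟩

/-- A linear map of Dieudonné modules which commutes with `F` and `V`. -/
structure IsEquivariant (j : M →ₗ[WittVector p k] M') : Prop where
  map_F : ∀ x, j (M.F x) = M'.F (j x)
  map_V : ∀ x, j (M.V x) = M'.V (j x)

theorem isEquivariant_of_lift {f : M.Rational →ₗ[WittVector p k] M'.Rational}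
    (hF : ∀ x, f (M.rationalF x) = M'.rationalF (f x))
    (hV : ∀ x, f (M.rationalV x) = M'.rationalV (f x)) {n : ℕ} {j : M →ₗ[WittVector p k] M'}
    (hj : ∀ x, M'.toRational (j x) = (p : WittVector p k) ^ n • f (M.toRational x)) :
    IsEquivariant j where
  map_F x := M'.toRational_injective (by
    rw [hj, ← rationalF_toRational, ← rationalF_toRational, hF, hj, LinearMap.map_smulₛₗ, map_pow,
      map_natCast])
  map_V x := M'.toRational_injective (by
    rw [hj, ← rationalV_toRational, ← rationalV_toRational, hV, hj, LinearMap.map_smulₛₗ, map_pow,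
      map_natCast])

/-- Isogenous Dieudonné modules are related by equivariant maps `j`, `j'` in both directions
whose composites are multiplication by a power of `p`. -/
theorem Isogenous.exists_maps (h : M.Isogenous M') :
    ∃ (n : ℕ) (j : M →ₗ[WittVector p k] M') (j' : M' →ₗ[WittVector p k] M),
      IsEquivariant j ∧ IsEquivariant j' ∧
      (∀ x, j (j' x) = (p : WittVector p k) ^ n • x) ∧
      (∀ x, j' (j x) = (p : WittVector p k) ^ n • x) := by
  obtain ⟨e, hF, hV⟩ := h
  obtain ⟨n, j, hj⟩ := exists_lift (e : M.Rational →ₗ[WittVector p k] M'.Rational)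
  obtain ⟨n', j', hj'⟩ := exists_lift (e.symm : M'.Rational →ₗ[WittVector p k] M.Rational)
  refine ⟨n + n', j, j', isEquivariant_of_lift hF hV hj,
    isEquivariant_of_lift (fun x => ?_) (fun x => ?_) hj', fun x => M'.toRational_injective ?_,
    fun x => M.toRational_injective ?_⟩
  · refine e.injective ((e.apply_symm_apply _).trans ?_)
    rw [hF]
    exact congrArg _ (e.apply_symm_apply x).symm
  · refine e.injective ((e.apply_symm_apply _).trans ?_)
    rw [hV]
    exact congrArg _ (e.apply_symm_apply x).symm
  · rw [hj, hj', map_smul, ← mul_smul, ← pow_add, map_smul]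
    congr 1
    exact e.apply_symm_apply _
  · rw [hj', hj, map_smul, ← mul_smul, ← pow_add, map_smul, add_comm n' n]
    congr 1
    exact e.symm_apply_apply _

/-- The number of unit entries in a diagonal form of `F` is an isogeny invariant. -/
theorem Isogenous.card_units_eq (h : M.Isogenous M') {I I' : Type*} [Fintype I] [Fintype I']
    (D : DiagonalForm M.F I) (D' : DiagonalForm M'.F I') : D.units.card = D'.units.card := by
  obtain ⟨n, j, j', hj, -, hjj', hj'j⟩ := h.exists_maps
  have hinj : Function.Injective j := fun x y hxy =>
    smul_right_injective M (pow_ne_zero n (WittVector.p_nonzero p k))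
      (by simpa only [hj'j] using congrArg j' hxy)
  have h1 := M.toFCrystal.latticeChain_nygaard D
  have h2 := M'.toFCrystal.latticeChain_nygaard D'
  rw [nygaard_toFCrystal] at h1 h2
  obtain ⟨m, hm⟩ := LatticeChain.exists_of_pow_smul_mem (N := n)
    (le_top : LinearMap.range j ≤ ⊤) (IsNoetherian.noetherian _) fun x _ => ⟨j' x, hjj' x⟩
  have h3 := LatticeChain.map j hinj h1
  have h4 := hm.map M'.V M'.V_injective
  -- The length of M' / VjM is computed through jM and through VM'. The two contributions of M' / jM
  -- cancel, as V preserves lengths.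
  have hcomm : ((⊤ : Submodule (WittVector p k) M).map M.V).map j =
      (LinearMap.range j).map M'.V := by
    ext y
    constructor
    · rintro ⟨_, ⟨x, -, rfl⟩, rfl⟩
      exact ⟨j x, ⟨x, rfl⟩, (hj.map_V x).symm⟩
    · rintro ⟨_, ⟨x, rfl⟩, rfl⟩
      exact ⟨_, ⟨x, trivial, rfl⟩, hj.map_V x⟩
  have h5 : LatticeChain (((⊤ : Submodule (WittVector p k) M).map M.V).map j) (LinearMap.range j)
      D.units.card := by
    rw [← Submodule.map_top]
    exact h3
  rw [hcomm] at h5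
  have : D.units.card + m = m + D'.units.card := (h5.trans hm).length_unique (h4.trans h2)
  omega

/-- The diagonal form of `F` on a tensor product. -/
noncomputable def tensorDiagonalForm {I J : Type*} (D : DiagonalForm M.F I)
    (E : DiagonalForm N.F J) : DiagonalForm (M.tensor N).F (I × J) where
  b := D.b.tensorProduct E.b
  u := D.u.tensorProduct E.u
  a i := D.a i.1 * E.a i.2
  map_b i := by
    have h : TensorProduct.map M.F N.F (D.b.tensorProduct E.b i) =
        (D.a i.1 * E.a i.2) • D.u.tensorProduct E.u i := by
      rw [Module.Basis.tensorProduct_apply', Module.Basis.tensorProduct_apply',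
        TensorProduct.map_tmul, D.map_b, E.map_b, TensorProduct.smul_tmul_smul]
    exact h

/-- Since p is prime, a product of entries is prime to p exactly when each factor is. -/
theorem card_units_tensorDiagonalForm {I J : Type*} [Fintype I] [Fintype J]
    (D : DiagonalForm M.F I) (E : DiagonalForm N.F J) :
    (tensorDiagonalForm D E).units.card = D.units.card * E.units.card := by
  rw [← Finset.card_product]
  congr 1
  ext i
  rw [Finset.mem_product, DiagonalForm.mem_units, DiagonalForm.mem_units, DiagonalForm.mem_units,
    ← not_or]
  exact not_congr prime_p.dvd_mul

/-- The diagonal form of `F` on an exterior square. -/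
noncomputable def exteriorDiagonalForm {I : Type*} [LinearOrder I] (D : DiagonalForm M.F I) :
    DiagonalForm M.exteriorSquare.F (Set.powersetCard I 2) where
  b := D.b.exteriorPower 2
  u := D.u.exteriorPower 2
  a s := ∏ i : Fin 2, D.a (Set.powersetCard.ofFinEmbEquiv.symm s i)
  map_b s := by
    have h : exteriorMap 2 M.F (D.b.exteriorPower 2 s) =
        (∏ i : Fin 2, D.a (Set.powersetCard.ofFinEmbEquiv.symm s i)) • D.u.exteriorPower 2 s := by
      rw [exteriorPower.basis_apply, exteriorPower.basis_apply]
      unfold exteriorPower.ιMulti_family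
      rw [exteriorMap_ιMulti, ← AlternatingMap.map_smul_univ]
      simp only [Function.comp_apply, D.map_b]
    exact h

/-- The entry at a two-element set is the product of the two entries of `D`, so the unit entries are
the pairs inside `D.units`. -/
theorem card_units_exteriorDiagonalForm {I : Type*} [LinearOrder I] [Fintype I]
    (D : DiagonalForm M.F I) :
    (exteriorDiagonalForm D).units.card = D.units.card.choose 2 := by
  rw [← Finset.card_powersetCard, ← Finset.card_map (Function.Embedding.subtype _)]
  congr 1
  have key : ∀ s : Set.powersetCard I 2,
      s ∈ (exteriorDiagonalForm D).units ↔ (s : Finset I) ⊆ D.units := by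
    intro s
    rw [DiagonalForm.mem_units]
    change ¬ _ ∣ ∏ i : Fin 2, D.a (Set.powersetCard.ofFinEmbEquiv.symm s i) ↔ _
    rw [prime_p.dvd_finsetProd_iff]
    push Not
    constructor
    · intro h x hx
      obtain ⟨i, rfl⟩ := (Set.powersetCard.mem_range_ofFinEmbEquiv_symm_iff_mem s x).mpr hx
      exact DiagonalForm.mem_units.mpr (h i (Finset.mem_univ i))
    · intro h i _
      exact DiagonalForm.mem_units.mp
        (h ((Set.powersetCard.mem_range_ofFinEmbEquiv_symm_iff_mem s _).mp ⟨i, rfl⟩))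
  ext s
  rw [Finset.mem_map, Finset.mem_powersetCard]
  constructor
  · rintro ⟨s, hs, rfl⟩
    exact ⟨(key s).mp hs, s.2⟩
  · rintro ⟨hs, hs'⟩
    exact ⟨⟨s, hs'⟩, (key _).mpr hs, rfl⟩

theorem tensorProduct_map_map {j₁ : M →ₗ[WittVector p k] M'} {j₁' : M' →ₗ[WittVector p k] M}
    {j₂ : N →ₗ[WittVector p k] N'} {j₂' : N' →ₗ[WittVector p k] N} {m n : ℕ}
    (h₁ : ∀ x, j₁' (j₁ x) = (p : WittVector p k) ^ m • x)
    (h₂ : ∀ x, j₂' (j₂ x) = (p : WittVector p k) ^ n • x) (x : M ⊗[WittVector p k] N) :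
    TensorProduct.map j₁' j₂' (TensorProduct.map j₁ j₂ x) =
      (p : WittVector p k) ^ (m + n) • x := by
  induction x using TensorProduct.induction_on with
  | zero => simp
  | tmul x y =>
    rw [TensorProduct.map_tmul, TensorProduct.map_tmul, h₁, h₂, TensorProduct.smul_tmul_smul,
      pow_add]
  | add x y hx hy => rw [map_add, map_add, hx, hy, smul_add]

theorem tensorProduct_map_comm {j₁ : M →ₗ[WittVector p k] M'} {j₂ : N →ₗ[WittVector p k] N'}
    (h₁ : IsEquivariant j₁) (h₂ : IsEquivariant j₂) (x : M ⊗[WittVector p k] N) :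
    TensorProduct.map j₁ j₂ (TensorProduct.map M.F N.F x) =
      TensorProduct.map M'.F N'.F (TensorProduct.map j₁ j₂ x) := by
  induction x using TensorProduct.induction_on with
  | zero => simp
  | tmul x y => simp only [TensorProduct.map_tmul, h₁.map_F, h₂.map_F]
  | add x y hx hy => simp only [map_add, hx, hy]

theorem dimU_tensor_eq (hM : M.Isogenous M') (hN : N.Isogenous N') :
    (M.tensor N).dimU = (M'.tensor N').dimU := by
  obtain ⟨m, j₁, j₁', hj₁, hj₁', hjj₁, hjj₁'⟩ := hM.exists_maps
  obtain ⟨n, j₂, j₂', hj₂, hj₂', hjj₂, hjj₂'⟩ := hN.exists_maps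
  obtain ⟨_, ⟨D⟩⟩ := M.exists_diagonalForm
  obtain ⟨_, ⟨D'⟩⟩ := M'.exists_diagonalForm
  obtain ⟨_, ⟨E⟩⟩ := N.exists_diagonalForm
  obtain ⟨_, ⟨E'⟩⟩ := N'.exists_diagonalForm
  have h := (M.tensor N).latticeChain_nygaard (tensorDiagonalForm D E)
  have h' := (M'.tensor N').latticeChain_nygaard (tensorDiagonalForm D' E')
  rw [card_units_tensorDiagonalForm, hM.card_units_eq D D', hN.card_units_eq E E'] at h
  rw [card_units_tensorDiagonalForm] at h'
  refine FCrystal.dimU_eq_of_quasiIsogeny (L' := M.tensor N) (L := M'.tensor N')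
    (j := TensorProduct.map j₁ j₂) (j' := TensorProduct.map j₁' j₂') (N := m + n)
    (tensorProduct_map_map hjj₁ hjj₂) (tensorProduct_map_map hjj₁' hjj₂')
    (tensorProduct_map_comm hj₁ hj₂) (tensorProduct_map_comm hj₁' hj₂') h' h

theorem exteriorPower_map_map {j : M →ₗ[WittVector p k] M'} {j' : M' →ₗ[WittVector p k] M} {n : ℕ}
    (h : ∀ x, j' (j x) = (p : WittVector p k) ^ n • x) (x : ⋀[WittVector p k]^2 M) :
    exteriorPower.map 2 j' (exteriorPower.map 2 j x) = (p : WittVector p k) ^ (n + n) • x := by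
  refine LinearMap.congr_fun (f := exteriorPower.map 2 j' ∘ₗ exteriorPower.map 2 j)
    (g := (p : WittVector p k) ^ (n + n) • LinearMap.id) ?_ x
  ext y
  simp only [LinearMap.compAlternatingMap_apply, LinearMap.comp_apply,
    exteriorPower.map_apply_ιMulti, LinearMap.smul_apply, LinearMap.id_apply]
  have h1 : (⇑j' ∘ ⇑j ∘ y) = fun i => (fun _ : Fin 2 => (p : WittVector p k) ^ n) i • y i :=
    funext fun i => h (y i)
  rw [h1, AlternatingMap.map_smul_univ]
  simp [pow_add, pow_two]

theorem exteriorPower_map_exteriorMap {j : M →ₗ[WittVector p k] M'} (hj : IsEquivariant j)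
    (x : ⋀[WittVector p k]^2 M) :
    exteriorPower.map 2 j (exteriorMap 2 M.F x) =
      exteriorMap 2 M'.F (exteriorPower.map 2 j x) := by
  have hx : x ∈ Submodule.span (WittVector p k)
      (Set.range (exteriorPower.ιMulti (WittVector p k) 2 (M := M))) := by
    rw [exteriorPower.ιMulti_span]
    trivial
  induction hx using Submodule.span_induction with
  | zero => simp
  | add x y _ _ hx hy => simp only [map_add, hx, hy]
  | smul a x _ hx => simp only [LinearMap.map_smulₛₗ, hx, RingHom.id_apply]
  | mem x hx =>
    obtain ⟨y, rfl⟩ := hx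
    rw [exteriorMap_ιMulti, exteriorPower.map_apply_ιMulti, exteriorPower.map_apply_ιMulti,
      exteriorMap_ιMulti]
    congr 1
    funext i
    exact hj.map_F (y i)

theorem dimU_exteriorSquare_eq (hM : M.Isogenous M') :
    M.exteriorSquare.dimU = M'.exteriorSquare.dimU := by
  obtain ⟨n, j, j', hj, hj', hjj, hjj'⟩ := hM.exists_maps
  obtain ⟨_, ⟨D⟩⟩ := M.exists_diagonalForm
  obtain ⟨_, ⟨D'⟩⟩ := M'.exists_diagonalForm
  have h := M.exteriorSquare.latticeChain_nygaard (exteriorDiagonalForm D)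
  have h' := M'.exteriorSquare.latticeChain_nygaard (exteriorDiagonalForm D')
  rw [card_units_exteriorDiagonalForm, hM.card_units_eq D D'] at h
  rw [card_units_exteriorDiagonalForm] at h'
  exact FCrystal.dimU_eq_of_quasiIsogeny (L' := M.exteriorSquare) (L := M'.exteriorSquare)
    (exteriorPower_map_map hjj) (exteriorPower_map_map hjj')
    (exteriorPower_map_exteriorMap hj) (exteriorPower_map_exteriorMap hj') h' h

end DieudonneModule

end Dieudonne

theorem mainTheorem12 (p : ℕ) [Fact p.Prime] (k : Type*) [Field k] [IsAlgClosed k] [CharP k p]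
    (M : Dieudonne.DieudonneModule p k) (M' : Dieudonne.DieudonneModule p k)
    (N : Dieudonne.DieudonneModule p k) (N' : Dieudonne.DieudonneModule p k)
    (hM : M.Isogenous M') (hN : N.Isogenous N') :
    (∃ d : ℕ, M.exteriorSquare.dimU = d ∧ M'.exteriorSquare.dimU = d) ∧
    (∃ d : ℕ, (M.tensor N).dimU = d ∧ (M'.tensor N').dimU = d) := by
  obtain ⟨d, hd⟩ := M.exteriorSquare.exists_dimU_eq
  obtain ⟨d', hd'⟩ := (M.tensor N).exists_dimU_eq
  exact ⟨⟨d, hd, (Dieudonne.DieudonneModule.dimU_exteriorSquare_eq hM).symm.trans hd⟩,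
    ⟨d', hd', (Dieudonne.DieudonneModule.dimU_tensor_eq hM hN).symm.trans hd'⟩⟩
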